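/- Let $1<p<\infty$, $1/p+1/p'=1$ and $b>0$; all spaces are real. Let $H:L_p(0,b)\to L_2(0,b)$ and $H^*:L_2(0,b)\to L_{p'}(0,b)$ be given by \[Hf(x)=\int_0^x f(t)\,dt,\qquad H^*g(x)=\int_x^b g(t)\,dt ,\] and let $K:=H^*H:L_p(0,b)\to L_{p'}(0,b)$, a map factorised through the Hilbert space $L_2(0,b)$. An extremal of $K$ is an $f\neq0$ in $L_p(0,b)$ with $\|Kf\|_{p'}=\|K\|\,\|f\|_p$. Write $[x]^{r-1}:=|x|^{r-2}x$ (with value $0$ at $x=0$). Consider the $(p,p')$-bi-Laplacian eigenvalue problem \[ ([u'']^{p-1})''=\lambda\,[u]^{p'-1}\quad\text{on }[0,b],\qquad u(0)=u'(b)=[u'']^{p-1}(0)=([u'']^{p-1})'(b)=0, \] for nontrivial classical solutions $u$: the functions $u$, $u'$, $[u'']^{p-1}$ and $([u'']^{p-1})'$ are differentiable on $[0,b]$ (one-sidedly at the end points), the equation holds at every point of $[0,b]$, and $\lambda\in\mathbb R$. As the two sides are homogeneous of different degrees when $p\neq2$, eigenvalues are compared under the normalisation $\|u''\|_p=1$: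 the first eigenvalue $\lambda_1$ is the least $\lambda$ that occurs for a normalised solution, and a first eigenfunction is a nonzero multiple of a normalised solution with $\lambda=\lambda_1$. Let $\sin_{2,p'}$ be the generalised sine: on $[0,\pi_{2,p'}/2]$ it is the inverse of $y\mapsto\int_0^y(1-t^{p'})^{-1/2}dt$, $0\le y\le1$, where $\pi_{2,p'}=2\int_0^1(1-t^{p'})^{-1/2}dt$. Then the following hold. 1. $\int_0^b (Hf)\,g\,dx=\int_0^b f\,(H^*g)\,dx$ for all $f\in L_p(0,b)$, $g\in L_2(0,b)$. 2. The extremals of $K$ correspond to the first eigenfunctions of the $(p,p')$-bi-Laplacian problem through $u(b-x)=(Kf)(x)$: an $f\in L_p(0,b)$ is an extremal of $K$ if and only if $(Kf)(x)=u(b-x)$ for almost every $x\in(0,b)$ with some first eigenfunction $u$, and every first eigenfunction arises in this way from an extremal. Moreover, $f$ is an extremal if and only if, for some $c\ne0$, $f(x)=c\,\bigl(\sin_{2,p'}\bigl(\tfrac{\pi_{2,p'}(b-x)}{2b}\bigr)\bigr)^{p'-1}$ for almost every $x\in(0,b)$. 3. The first eigenfunctions are exactly the nonzero multiples of $\sin_{2,p'}\bigl(\tfrac{\pi_{2,p'}x}{2b}\bigr)$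 on $[0,b]$. 4. For $c\neq0$, the function $c\,\sin_{2,p'}\bigl(\tfrac{\pi_{2,p'}x}{2b}\bigr)$ solves the problem with \[\lambda=|c|^{\,p-p'}\Bigl(\tfrac{p'}{2}\bigl(\tfrac{\pi_{2,p'}}{2b}\bigr)^2\Bigr)^{p}.\] 5. The first eigenvalue is $\lambda_1=\|K\|^{-p'}$, where, with the Euler beta function $B$, \[\|K\|=\frac{b^{1+2/p'}\,(p'+2)^{1-2/p'}\,p'\,2^{2/p'}}{B(1/p',1/2)^2}.\] -/

import Mathlib

open MeasureTheory Set

noncomputable section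

/-- Lebesgue measure on the interval `(0, b)`. -/
abbrev volIoo (b : ℝ) : Measure ℝ := volume.restrict (Ioo 0 b)

/-- The real Lebesgue space `L_p(0, b)`. -/
abbrev LpIoo (p b : ℝ) : Type := Lp ℝ (ENNReal.ofReal p) (volIoo b)

/-- The Hardy operator on functions, `(H f)(x) = ∫_0^x f(t) dt`. -/
def hardyFun (f : ℝ → ℝ) (x : ℝ) : ℝ := ∫ t in (0 : ℝ)..x, f t

/-- The dual Hardy operator on functions, `(H^* f)(x) = ∫_x^b f(t) dt`. -/
def hardyDualFun (b : ℝ) (f : ℝ → ℝ) (x : ℝ) : ℝ := ∫ t in x..b, f t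

theorem integrableOn_Ioc_of_lp {p b : ℝ} [hp : Fact (1 ≤ ENNReal.ofReal p)] (f : LpIoo p b) :
    IntegrableOn f (Ioc 0 b) := by
  rw [integrableOn_Ioc_iff_integrableOn_Ioo]
  exact (Lp.memLp f).integrable hp.out

theorem intervalIntegrable_of_lp {p b x y : ℝ} [Fact (1 ≤ ENNReal.ofReal p)] (f : LpIoo p b)
    (hx : 0 ≤ x) (hxy : x ≤ y) (hy : y ≤ b) : IntervalIntegrable f volume x y := by
  rw [intervalIntegrable_iff_integrableOn_Ioc_of_le hxy]
  exact (integrableOn_Ioc_of_lp f).mono_set (Ioc_subset_Ioc hx hy)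

theorem norm_intervalIntegral_le_of_lp {p b x y : ℝ} [Fact (1 ≤ ENNReal.ofReal p)] (f : LpIoo p b)
    (hx : 0 ≤ x) (hxy : x ≤ y) (hy : y ≤ b) :
    ‖∫ t in x..y, f t‖ ≤ ∫ t, ‖f t‖ ∂(volIoo b) := by
  rw [intervalIntegral.integral_of_le hxy, ← integral_Ioc_eq_integral_Ioo]
  exact (norm_integral_le_integral_norm _).trans
    (setIntegral_mono_set (integrableOn_Ioc_of_lp f).norm
      (Filter.Eventually.of_forall fun _ => norm_nonneg _)
      (LE.le.eventuallyLE (Ioc_subset_Ioc hx hy)))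

theorem integral_norm_le_of_lp {p b : ℝ} [hp : Fact (1 ≤ ENNReal.ofReal p)] (f : LpIoo p b) :
    ∫ t, ‖f t‖ ∂(volIoo b) ≤
      ‖f‖ * ((volIoo b univ) ^ (1 / (1 : ENNReal).toReal - 1 / (ENNReal.ofReal p).toReal)).toReal := by
  have h := eLpNorm_le_eLpNorm_mul_rpow_measure_univ (μ := volIoo b) hp.out
    (Lp.aestronglyMeasurable f)
  have hne : (volIoo b univ) ^ (1 / (1 : ENNReal).toReal - 1 / (ENNReal.ofReal p).toReal) ≠ ⊤ := by
    apply ENNReal.rpow_ne_top_of_nonneg _ (measure_ne_top _ _)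
    have h1 : 1 ≤ (ENNReal.ofReal p).toReal := by
      simpa using ENNReal.toReal_mono ENNReal.ofReal_ne_top hp.out
    have h2 : 1 / (ENNReal.ofReal p).toReal ≤ 1 := by
      rw [div_le_one (by linarith)]; exact h1
    simpa using h2
  rw [Lp.norm_def, ← ENNReal.toReal_mul, integral_norm_eq_lintegral_enorm
    (Lp.aestronglyMeasurable f), ← eLpNorm_one_eq_lintegral_enorm]
  exact ENNReal.toReal_mono (ENNReal.mul_ne_top (Lp.eLpNorm_ne_top f) hne) h

theorem memLp_hardyFun {p b : ℝ} (q : ℝ) [Fact (1 ≤ ENNReal.ofReal p)] (f : LpIoo p b) :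
    MemLp (hardyFun f) (ENNReal.ofReal q) (volIoo b) := by
  refine MemLp.of_bound ?_ (∫ t, ‖f t‖ ∂(volIoo b)) ?_
  · refine ContinuousOn.aestronglyMeasurable ?_ measurableSet_Ioo
    rcases le_or_gt b 0 with hb | hb
    · rw [Ioo_eq_empty (by linarith)]; exact continuousOn_empty _
    have h := intervalIntegral.continuousOn_primitive_interval (a := 0) (b := b) (f := f)
      (μ := volume) (by
        rw [uIcc_of_le hb.le, integrableOn_Icc_iff_integrableOn_Ioc]
        exact integrableOn_Ioc_of_lp f)
    rw [uIcc_of_le hb.le] at h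
    exact h.mono Ioo_subset_Icc_self
  · filter_upwards [ae_restrict_mem measurableSet_Ioo] with x hx
    exact norm_intervalIntegral_le_of_lp f le_rfl hx.1.le hx.2.le

theorem hardyDualFun_eq {p b x : ℝ} [Fact (1 ≤ ENNReal.ofReal p)] (f : LpIoo p b)
    (hx : x ∈ Ioo 0 b) : hardyDualFun b f x = hardyFun f b - hardyFun f x := by
  have h1 := intervalIntegrable_of_lp f le_rfl hx.1.le hx.2.le
  have h2 := intervalIntegrable_of_lp f hx.1.le hx.2.le le_rfl
  rw [hardyDualFun, hardyFun, hardyFun, ← intervalIntegral.integral_add_adjacent_intervals h1 h2]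
  ring

theorem memLp_hardyDualFun {p b : ℝ} (q : ℝ) [Fact (1 ≤ ENNReal.ofReal p)] (f : LpIoo p b) :
    MemLp (hardyDualFun b f) (ENNReal.ofReal q) (volIoo b) := by
  refine MemLp.ae_eq ?_ ((memLp_const (hardyFun f b)).sub (memLp_hardyFun q f))
  filter_upwards [ae_restrict_mem measurableSet_Ioo] with x hx
  rw [hardyDualFun_eq f hx]; rfl

theorem intervalIntegral_add_lp {p b x y : ℝ} [Fact (1 ≤ ENNReal.ofReal p)] (f g : LpIoo p b)
    (hx : 0 ≤ x) (hxy : x ≤ y) (hy : y ≤ b) :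
    ∫ t in x..y, (f + g : LpIoo p b) t = (∫ t in x..y, f t) + ∫ t in x..y, g t := by
  rw [← intervalIntegral.integral_add (intervalIntegrable_of_lp f hx hxy hy)
    (intervalIntegrable_of_lp g hx hxy hy), intervalIntegral.integral_of_le hxy,
    intervalIntegral.integral_of_le hxy, integral_Ioc_eq_integral_Ioo,
    integral_Ioc_eq_integral_Ioo]
  exact integral_congr_ae (ae_restrict_of_ae_restrict_of_subset (Ioo_subset_Ioo hx hy)
    (Lp.coeFn_add f g))

theorem intervalIntegral_smul_lp {p b x y : ℝ} (c : ℝ) (f : LpIoo p b)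
    (hx : 0 ≤ x) (hxy : x ≤ y) (hy : y ≤ b) :
    ∫ t in x..y, (c • f : LpIoo p b) t = c * ∫ t in x..y, f t := by
  rw [← intervalIntegral.integral_const_mul, intervalIntegral.integral_of_le hxy,
    intervalIntegral.integral_of_le hxy, integral_Ioc_eq_integral_Ioo,
    integral_Ioc_eq_integral_Ioo]
  exact integral_congr_ae (ae_restrict_of_ae_restrict_of_subset (Ioo_subset_Ioo hx hy)
    (Lp.coeFn_smul c f))

/-- The Hardy operator `H : L_p(0, b) → L_q(0, b)` as a bounded linear map. -/
def hardy (p q b : ℝ) [Fact (1 ≤ ENNReal.ofReal p)] [Fact (1 ≤ ENNReal.ofReal q)] :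
    LpIoo p b →L[ℝ] LpIoo q b :=
  LinearMap.mkContinuousOfExistsBound
    { toFun := fun f => (memLp_hardyFun q f).toLp (hardyFun f)
      map_add' := fun f g => by
        rw [← MemLp.toLp_add, MemLp.toLp_eq_toLp_iff]
        filter_upwards [ae_restrict_mem measurableSet_Ioo] with x hx
        exact intervalIntegral_add_lp f g le_rfl hx.1.le hx.2.le
      map_smul' := fun c f => by
        rw [RingHom.id_apply, ← MemLp.toLp_const_smul, MemLp.toLp_eq_toLp_iff]
        filter_upwards [ae_restrict_mem measurableSet_Ioo] with x hx
        exact intervalIntegral_smul_lp c f le_rfl hx.1.le hx.2.le }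
    (by
      refine ⟨((measureUnivNNReal (volIoo b) : ℝ) ^ (ENNReal.ofReal q).toReal⁻¹) *
        ((volIoo b univ) ^
          (1 / (1 : ENNReal).toReal - 1 / (ENNReal.ofReal p).toReal)).toReal, fun f => ?_⟩
      rw [mul_assoc, mul_comm _ ‖f‖]
      refine (Lp.norm_le_of_ae_bound (C := ∫ t, ‖f t‖ ∂(volIoo b))
        (integral_nonneg fun _ => norm_nonneg _) ?_).trans
        (mul_le_mul_of_nonneg_left (integral_norm_le_of_lp f) (by positivity))
      filter_upwards [ae_restrict_mem measurableSet_Ioo,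
        (memLp_hardyFun q f).coeFn_toLp] with x hx hx'
      refine (congrArg norm hx').le.trans ?_
      exact norm_intervalIntegral_le_of_lp f le_rfl hx.1.le hx.2.le)

/-- The dual Hardy operator `H^* : L_p(0, b) → L_q(0, b)` as a bounded linear map. -/
def hardyDual (p q b : ℝ) [Fact (1 ≤ ENNReal.ofReal p)] [Fact (1 ≤ ENNReal.ofReal q)] :
    LpIoo p b →L[ℝ] LpIoo q b :=
  LinearMap.mkContinuousOfExistsBound
    { toFun := fun f => (memLp_hardyDualFun q f).toLp (hardyDualFun b f)
      map_add' := fun f g => by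
        rw [← MemLp.toLp_add, MemLp.toLp_eq_toLp_iff]
        filter_upwards [ae_restrict_mem measurableSet_Ioo] with x hx
        exact intervalIntegral_add_lp f g hx.1.le hx.2.le le_rfl
      map_smul' := fun c f => by
        rw [RingHom.id_apply, ← MemLp.toLp_const_smul, MemLp.toLp_eq_toLp_iff]
        filter_upwards [ae_restrict_mem measurableSet_Ioo] with x hx
        exact intervalIntegral_smul_lp c f hx.1.le hx.2.le le_rfl }
    (by
      refine ⟨((measureUnivNNReal (volIoo b) : ℝ) ^ (ENNReal.ofReal q).toReal⁻¹) *
        ((volIoo b univ) ^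
          (1 / (1 : ENNReal).toReal - 1 / (ENNReal.ofReal p).toReal)).toReal, fun f => ?_⟩
      rw [mul_assoc, mul_comm _ ‖f‖]
      refine (Lp.norm_le_of_ae_bound (C := ∫ t, ‖f t‖ ∂(volIoo b))
        (integral_nonneg fun _ => norm_nonneg _) ?_).trans
        (mul_le_mul_of_nonneg_left (integral_norm_le_of_lp f) (by positivity))
      filter_upwards [ae_restrict_mem measurableSet_Ioo,
        (memLp_hardyDualFun q f).coeFn_toLp] with x hx hx'
      refine (congrArg norm hx').le.trans ?_
      exact norm_intervalIntegral_le_of_lp f hx.1.le hx.2.le le_rfl)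

instance factOneLeOfRealTwo : Fact (1 ≤ ENNReal.ofReal 2) :=
  ⟨by rw [ENNReal.one_le_ofReal]; norm_num⟩

/-- The Hilbertian map `K = H^* H`, factorised through the Hilbert space `L_2(0, b)`:
`L_p(0, b) → L_2(0, b) → L_q(0, b)`; it is used with `q = p'`. -/
def hilbertianK (p q b : ℝ) [Fact (1 ≤ ENNReal.ofReal p)] [Fact (1 ≤ ENNReal.ofReal q)] :
    LpIoo p b →L[ℝ] LpIoo q b :=
  (hardyDual 2 q b).comp (hardy p 2 b)

/-- `x` is an extremal of the bounded linear map `T`: it is nonzero and the quotient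
`‖T x‖ / ‖x‖` attains the operator norm. -/
def IsExtremal {X Y : Type*} [NormedAddCommGroup X] [NormedSpace ℝ X] [NormedAddCommGroup Y]
    [NormedSpace ℝ Y] (T : X →L[ℝ] Y) (x : X) : Prop :=
  x ≠ 0 ∧ ‖T x‖ = ‖T‖ * ‖x‖

/-- `∫_0^y (1 - t^q)^(-1/p) dt`, which for `0 ≤ y ≤ 1` is the inverse of `sin_{p,q}`. -/
def arcsinPQ (p q y : ℝ) : ℝ := ∫ t in (0 : ℝ)..y, (1 - t ^ q) ^ (-1 / p)

/-- The number `π_{p,q}`. -/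
def piPQ (p q : ℝ) : ℝ := 2 * arcsinPQ p q 1

/-- The inverse of `arcsinPQ p q` on `[0, 1]`; meaningful on `[0, π_{p,q} / 2]`. -/
def sinPQAux (p q : ℝ) : ℝ → ℝ := Function.invFunOn (arcsinPQ p q) (Icc 0 1)

/-- The generalised sine `sin_{p,q}`: the inverse of `arcsinPQ` on `[0, π_{p,q} / 2]`, extended to
`[0, π_{p,q}]` by symmetry about `π_{p,q} / 2`, then to an odd function of period `2 π_{p,q}`.
The real `y` is the representative of `x` in `[-π_{p,q} / 2, 3 π_{p,q} / 2)`. -/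
def sinPQ (p q x : ℝ) : ℝ :=
  let y := x - 2 * piPQ p q * ⌊(x + piPQ p q / 2) / (2 * piPQ p q)⌋
  if y < 0 then -sinPQAux p q (-y)
  else if y ≤ piPQ p q / 2 then sinPQAux p q y
  else if y ≤ piPQ p q then sinPQAux p q (piPQ p q - y)
  else -sinPQAux p q (y - piPQ p q)

/-- The signed power `[x]^(p-1) = |x|^(p-2) x`, which gives the duality map of `L_p`. -/
def signedPow (p x : ℝ) : ℝ := |x| ^ (p - 2) * x

/-- Derivative on the closed interval `[0, b]` (one-sided at the end points). -/
def derivIcc (b : ℝ) (u : ℝ → ℝ) : ℝ → ℝ := derivWithin u (Icc 0 b)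

/-- `u` is a nontrivial classical solution, with eigenvalue `lam`, of the bi-Laplacian problem
`([u'']^(p-1))'' = lam [u]^(q-1)` on `[0, b]`,
`u(0) = u'(b) = [u'']^(p-1)(0) = ([u'']^(p-1))'(b) = 0`; it is used with `q = p'`. -/
structure IsEigenpair (p q b lam : ℝ) (u : ℝ → ℝ) : Prop where
  nontrivial : ∃ x ∈ Icc 0 b, u x ≠ 0
  diff_zero : DifferentiableOn ℝ u (Icc 0 b)
  diff_one : DifferentiableOn ℝ (derivIcc b u) (Icc 0 b)
  diff_two : DifferentiableOn ℝ
    (fun x => signedPow p (derivIcc b (derivIcc b u) x)) (Icc 0 b)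
  diff_three : DifferentiableOn ℝ
    (derivIcc b fun x => signedPow p (derivIcc b (derivIcc b u) x)) (Icc 0 b)
  equation : ∀ x ∈ Icc 0 b,
    derivIcc b (derivIcc b fun x => signedPow p (derivIcc b (derivIcc b u) x)) x
      = lam * signedPow q (u x)
  bc_zero : u 0 = 0
  bc_one : derivIcc b u b = 0
  bc_two : signedPow p (derivIcc b (derivIcc b u) 0) = 0
  bc_three : derivIcc b (fun x => signedPow p (derivIcc b (derivIcc b u) x)) b = 0

/-- An eigenpair normalised by `‖u''‖_p = 1`. The equation is not homogeneous if `p ≠ q`, so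
eigenvalues can be compared only after a normalisation. -/
def IsNormalizedEigenpair (p q b lam : ℝ) (u : ℝ → ℝ) : Prop :=
  IsEigenpair p q b lam u ∧ ∫ x in (0 : ℝ)..b, |derivIcc b (derivIcc b u) x| ^ p = 1

/-- The first eigenvalue: the least eigenvalue of a normalised eigenfunction. -/
def IsFirstEigenvalue (p q b lam : ℝ) : Prop :=
  IsLeast {m : ℝ | ∃ v : ℝ → ℝ, IsNormalizedEigenpair p q b m v} lam

/-- A first eigenfunction: a nonzero multiple of it is a normalised eigenfunction that belongs to
the first eigenvalue. -/
def IsFirstEigenfunction (p q b : ℝ) (u : ℝ → ℝ) : Prop :=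
  ∃ c lam : ℝ, c ≠ 0 ∧ IsFirstEigenvalue p q b lam ∧
    IsNormalizedEigenpair p q b lam fun x => c * u x

end

noncomputable section

/-! Write q = p', S = `quarterSin q b` and k = `sinFreq q b`. On [0, b] the function S rises from 0
to 1, with S' = k √(1 - S^q) and S'' = -(q/2) k² S^(q-1), so that S'(b) = 0.

The core is a sharp Sobolev inequality: among w with w(0) = 0 and a fixed integral of |w|^q, the
energy ∫ w'² is least exactly for multiples of S (`energy_lower_bound`, `sobolev_quarter`). The
proof is a calibration. Let M = max |w| be attained at x₀, where w(x₀) = M after a change of sign,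
and put s(y) = k √(1 - (|y|/M)^q). Completing the square on [0, x₀] bounds w'² below by 2 s(w) w' -
s(w)²; on [x₀, b] one uses only w'² ≥ -s(w)². The integral of s(w) w' depends only on M, and that of
s(w)² only on M and the prescribed integral. What remains is q M + M^(-q) ≥ q + 1, with equality
only at M = 1.

For the operator, let w(x) = (Kf)(b - x), so that w'(x) = (Hf)(b - x). Duality and Hölder give ∫ w'²
= ∫ (Hf)² = ∫ f Kf ≤ ‖f‖ ‖Kf‖, and the Sobolev inequality gives ‖Kf‖² ≤ C ∫ w'². Hence ‖Kf‖ ≤ C ‖f‖,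
and equality forces w to be a multiple of S (`norm_hilbertianK_le`). Conversely f = S(b - ·)^(q-1)
attains equality. As K is injective, this determines all extremals.

For the eigenvalue problem, set f(x) = -u''(b - x). The boundary conditions on u and u' give (Kf)(b
- x) = u(x). Testing the equation with u gives ∫ |u''|^p = λ ∫ |u|^q, so a normalised solution has
‖f‖ = 1 and λ = ‖Kf‖^(-q) (`IsNormalizedEigenpair.exists_lp`). Thus λ ≥ ‖K‖^(-q), with equality
exactly when f is an extremal. The beta function enters through the value of π_{2,q}. -/

/-! ### The generalised arcsine on [0, 1]. -/

theorem arcsin_integrand_intervalIntegrable {q : ℝ} (hq : 1 < q) :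
    IntervalIntegrable (fun t : ℝ => (1 - t ^ q) ^ (-1 / (2 : ℝ))) volume 0 1 := by
  have h : IntervalIntegrable (fun t : ℝ => (1 - t) ^ (-1 / (2 : ℝ))) volume 0 1 := by
    have := (intervalIntegral.intervalIntegrable_rpow' (a := 0) (b := 1) (r := -1 / (2 : ℝ))
      (by norm_num)).comp_sub_left 1
    simpa using this.symm
  refine h.mono_fun ?_ ?_
  · refine Measurable.aestronglyMeasurable ?_
    fun_prop
  · rw [uIoc_of_le zero_le_one]
    have h1 : ∀ᵐ x : ℝ ∂(volume.restrict (Ioc 0 1)), x ≠ 1 :=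
      ae_restrict_of_ae (by simp [ae_iff, measure_singleton])
    filter_upwards [ae_restrict_mem measurableSet_Ioc, h1] with x hx hx1
    have hx2 : x < 1 := lt_of_le_of_ne hx.2 hx1
    -- Since q > 1, 1 - x^q ≥ 1 - x, so the singularity at 1 is no worse than that of (1 -
    -- x)^(-1/2).
    have h3 : x ^ q ≤ x := by
      simpa using Real.rpow_le_rpow_of_exponent_ge hx.1 hx.2 hq.le
    rw [Real.norm_of_nonneg (Real.rpow_nonneg (by linarith) _),
      Real.norm_of_nonneg (Real.rpow_nonneg (by linarith) _)]
    exact Real.rpow_le_rpow_of_nonpos (by linarith) (by linarith) (by norm_num)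

/-- Negative bases are included: the real power there is still at most |y|^q in absolute value. This
makes the arcsine differentiable from both sides at 0. -/
theorem rpow_lt_one_of_abs_lt_one {q y : ℝ} (hq : 0 < q) (hy : |y| < 1) : y ^ q < 1 :=
  (le_abs_self _).trans_lt ((Real.abs_rpow_le_abs_rpow y q).trans_lt
    (Real.rpow_lt_one (abs_nonneg _) hy hq))

theorem hasDerivAt_arcsinPQ {q y : ℝ} (hq : 1 < q) (hy : |y| < 1) :
    HasDerivAt (arcsinPQ 2 q) ((1 - y ^ q) ^ (-1 / (2 : ℝ))) y := by
  have hc : ∀ z : ℝ, |z| < 1 → ContinuousAt (fun t : ℝ => (1 - t ^ q) ^ (-1 / (2 : ℝ))) z := by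
    intro z hz
    have := rpow_lt_one_of_abs_lt_one (q := q) (by linarith) hz
    exact ContinuousAt.rpow_const
      (continuousAt_const.sub (Real.continuous_rpow_const (by linarith)).continuousAt)
      (Or.inl (by linarith))
  refine intervalIntegral.integral_hasDerivAt_right ?_ ?_ (hc y hy)
  · refine ContinuousOn.intervalIntegrable fun z hz => (hc z ?_).continuousWithinAt
    rw [abs_lt] at hy ⊢
    rcases le_total 0 y with h | h
    · rw [uIcc_of_le h] at hz; constructor <;> linarith [hz.1, hz.2]
    · rw [uIcc_of_ge h] at hz; constructor <;> linarith [hz.1, hz.2]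
  · exact (Measurable.stronglyMeasurable (by fun_prop)).stronglyMeasurableAtFilter

theorem arcsinPQ_zero (p q : ℝ) : arcsinPQ p q 0 = 0 := by simp [arcsinPQ]

theorem continuousOn_arcsinPQ {q : ℝ} (hq : 1 < q) : ContinuousOn (arcsinPQ 2 q) (Icc 0 1) := by
  have h := intervalIntegral.continuousOn_primitive_interval (a := 0) (b := 1) (μ := volume)
    (f := fun t : ℝ => (1 - t ^ q) ^ (-1 / (2 : ℝ))) (by
      rw [uIcc_of_le zero_le_one, integrableOn_Icc_iff_integrableOn_Ioc]
      exact (intervalIntegrable_iff_integrableOn_Ioc_of_le zero_le_one).1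
        (arcsin_integrand_intervalIntegrable hq))
  rwa [uIcc_of_le zero_le_one] at h

/-- The integrand is at least 1 on (0, 1). This yields strict monotonicity of the arcsine and the
Lipschitz bound for its inverse. -/
theorem sub_le_arcsinPQ_sub {q y z : ℝ} (hq : 1 < q) (hz : 0 ≤ z) (hzy : z ≤ y) (hy : y ≤ 1) :
    y - z ≤ arcsinPQ 2 q y - arcsinPQ 2 q z := by
  have hd : ∀ x ∈ Ioo z y, HasDerivAt (fun x => arcsinPQ 2 q x - x)
      ((1 - x ^ q) ^ (-1 / (2 : ℝ)) - 1) x := fun x hx =>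
    (hasDerivAt_arcsinPQ hq (by rw [abs_lt]; constructor <;> linarith [hx.1, hx.2])).sub
      (hasDerivAt_id x)
  have := monotoneOn_of_deriv_nonneg (convex_Icc z y)
    (((continuousOn_arcsinPQ hq).mono (Icc_subset_Icc hz hy)).sub continuousOn_id)
    (fun x hx => by
      rw [interior_Icc] at hx
      exact (hd x hx).differentiableAt.differentiableWithinAt)
    (fun x hx => by
      rw [interior_Icc] at hx
      change 0 ≤ deriv (fun x => arcsinPQ 2 q x - x) x
      rw [(hd x hx).deriv, sub_nonneg]
      have h0 : 0 < x := by linarith [hx.1]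
      have h1 : x ^ q < 1 := Real.rpow_lt_one h0.le (by linarith [hx.2]) (by linarith)
      have h2 : 0 < x ^ q := Real.rpow_pos_of_pos h0 _
      exact Real.one_le_rpow_of_pos_of_le_one_of_nonpos (by linarith) (by linarith) (by norm_num))
    (left_mem_Icc.2 hzy) (right_mem_Icc.2 hzy) hzy
  simp only [Pi.sub_apply, id] at this
  linarith

theorem one_le_arcsinPQ_one {q : ℝ} (hq : 1 < q) : 1 ≤ arcsinPQ 2 q 1 := by
  simpa [arcsinPQ_zero] using sub_le_arcsinPQ_sub hq le_rfl zero_le_one le_rfl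

/-! ### The rescaled generalised sine, its derivatives and its integrals. -/

/-- The frequency `π_{2,q} / (2 b)`. -/
def sinFreq (q b : ℝ) : ℝ := piPQ 2 q / (2 * b)

/-- The generalised sine `sin_{2,q}` with a quarter period rescaled to `[0, b]`. -/
def quarterSin (q b x : ℝ) : ℝ := sinPQ 2 q (piPQ 2 q * x / (2 * b))

theorem piPQ_pos {q : ℝ} (hq : 1 < q) : 0 < piPQ 2 q := by
  have := one_le_arcsinPQ_one hq
  rw [piPQ]; linarith

theorem sinFreq_pos {q b : ℝ} (hq : 1 < q) (hb : 0 < b) : 0 < sinFreq q b :=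
  div_pos (piPQ_pos hq) (by linarith)

theorem sinFreq_mul {q b : ℝ} (hb : 0 < b) : sinFreq q b * b = arcsinPQ 2 q 1 := by
  rw [sinFreq, piPQ]; field_simp

theorem quarterSin_spec {q b x : ℝ} (hq : 1 < q) (hb : 0 < b) (hx : x ∈ Icc 0 b) :
    quarterSin q b x ∈ Icc 0 1 ∧ arcsinPQ 2 q (quarterSin q b x) = sinFreq q b * x := by
  have hk := sinFreq_pos hq hb
  have hpi := piPQ_pos hq
  have hkb : sinFreq q b * b = piPQ 2 q / 2 := by rw [sinFreq_mul hb, piPQ]; ring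
  have harg : piPQ 2 q * x / (2 * b) = sinFreq q b * x := by rw [sinFreq]; ring
  have h0 : 0 ≤ sinFreq q b * x := mul_nonneg hk.le hx.1
  have h1 : sinFreq q b * x ≤ piPQ 2 q / 2 := by
    rw [← hkb]; exact mul_le_mul_of_nonneg_left hx.2 hk.le
  -- On the first quarter period the periodic extension is inactive, so only the inverse of the
  -- arcsine is left.
  have hfl : ⌊(sinFreq q b * x + piPQ 2 q / 2) / (2 * piPQ 2 q)⌋ = 0 := by
    rw [Int.floor_eq_zero_iff]
    constructor
    · positivity
    · rw [div_lt_one (by positivity)]; linarith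
  have hS : quarterSin q b x = sinPQAux 2 q (sinFreq q b * x) := by
    rw [quarterSin, harg, sinPQ]
    simp [hfl, h0.not_gt, h1]
  have hmem : ∃ y ∈ Icc (0 : ℝ) 1, arcsinPQ 2 q y = sinFreq q b * x := by
    have := intermediate_value_Icc zero_le_one (continuousOn_arcsinPQ hq)
    rw [arcsinPQ_zero, ← sinFreq_mul hb, hkb] at this
    exact this ⟨h0, h1⟩
  rw [hS, sinPQAux]
  exact Function.invFunOn_pos hmem

theorem arcsinPQ_strictMonoOn {q : ℝ} (hq : 1 < q) : StrictMonoOn (arcsinPQ 2 q) (Icc 0 1) :=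
  fun y hy z hz hyz => by linarith [sub_le_arcsinPQ_sub hq hy.1 hyz.le hz.2]

theorem eq_quarterSin {q b x y : ℝ} (hq : 1 < q) (hb : 0 < b) (hx : x ∈ Icc 0 b)
    (hy : y ∈ Icc 0 1) (h : arcsinPQ 2 q y = sinFreq q b * x) : y = quarterSin q b x :=
  (arcsinPQ_strictMonoOn hq).injOn hy (quarterSin_spec hq hb hx).1
    (h.trans (quarterSin_spec hq hb hx).2.symm)

theorem quarterSin_zero {q b : ℝ} (hq : 1 < q) (hb : 0 < b) : quarterSin q b 0 = 0 :=
  (eq_quarterSin hq hb (left_mem_Icc.2 hb.le) (by simp) (by simp [arcsinPQ_zero])).symm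

theorem quarterSin_right {q b : ℝ} (hq : 1 < q) (hb : 0 < b) : quarterSin q b b = 1 :=
  (eq_quarterSin hq hb (right_mem_Icc.2 hb.le) (by simp) (sinFreq_mul hb).symm).symm

theorem quarterSin_mem_Ioo {q b x : ℝ} (hq : 1 < q) (hb : 0 < b) (hx : x ∈ Ioo 0 b) :
    quarterSin q b x ∈ Ioo 0 1 := by
  obtain ⟨h1, h2⟩ := quarterSin_spec hq hb (Ioo_subset_Icc_self hx)
  have hk := sinFreq_pos hq hb
  refine ⟨lt_of_le_of_ne h1.1 fun h => ?_, lt_of_le_of_ne h1.2 fun h => ?_⟩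
  · rw [← h, arcsinPQ_zero] at h2
    nlinarith [mul_pos hk hx.1]
  · rw [h, ← sinFreq_mul hb] at h2
    exact hx.2.ne (mul_left_cancel₀ hk.ne' h2).symm

theorem continuousOn_quarterSin {q b : ℝ} (hq : 1 < q) (hb : 0 < b) :
    ContinuousOn (quarterSin q b) (Icc 0 b) := by
  have hk := sinFreq_pos hq hb
  refine (LipschitzOnWith.of_dist_le_mul (K := ⟨sinFreq q b, hk.le⟩) ?_).continuousOn
  have key : ∀ x ∈ Icc 0 b, ∀ y ∈ Icc 0 b, quarterSin q b x ≤ quarterSin q b y →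
      |quarterSin q b x - quarterSin q b y| ≤ sinFreq q b * |x - y| := by
    intro x hx y hy h
    obtain ⟨hx1, hx2⟩ := quarterSin_spec hq hb hx
    obtain ⟨hy1, hy2⟩ := quarterSin_spec hq hb hy
    have := sub_le_arcsinPQ_sub hq hx1.1 h hy1.2
    rw [abs_sub_comm, abs_of_nonneg (by linarith), abs_sub_comm]
    rw [hx2, hy2, ← mul_sub] at this
    exact this.trans (mul_le_mul_of_nonneg_left (le_abs_self _) hk.le)
  intro x hx y hy
  simp only [Real.dist_eq]
  rcases le_total (quarterSin q b x) (quarterSin q b y) with h | h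
  · exact key x hx y hy h
  · rw [abs_sub_comm, abs_sub_comm x]; exact key y hy x hx h

/-- By continuity u is the primitive of v up to the end points, so the derivative formula extends
there. It is needed because the inverse function rule fails at the right end, where the arcsine has
infinite slope. -/
theorem hasDerivWithinAt_Icc_of_Ioo {b : ℝ} {u v : ℝ → ℝ}
    (hu : ContinuousOn u (Icc 0 b)) (hv : ContinuousOn v (Icc 0 b))
    (h : ∀ x ∈ Ioo 0 b, HasDerivAt u (v x) x) {x : ℝ} (hx : x ∈ Icc 0 b) :
    HasDerivWithinAt u (v x) (Icc 0 b) x := by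
  have hvi : ∀ y ∈ Icc 0 b, IntervalIntegrable v volume 0 y := fun y hy =>
    (hv.mono (by rw [uIcc_of_le hy.1]; exact Icc_subset_Icc_right hy.2)).intervalIntegrable
  have hrep : ∀ y ∈ Icc 0 b, u y = u 0 + ∫ t in (0 : ℝ)..y, v t := fun y hy => by
    rw [intervalIntegral.integral_eq_sub_of_hasDerivAt_of_le hy.1
      (hu.mono (Icc_subset_Icc_right hy.2)) (fun z hz => h z ⟨hz.1, hz.2.trans_le hy.2⟩)
      (hvi y hy)]
    ring
  -- The fundamental theorem of calculus within `Icc` finds this membership by instance search.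
  have : Fact (x ∈ Icc 0 b) := ⟨hx⟩
  have hd : HasDerivWithinAt (fun y => ∫ t in (0 : ℝ)..y, v t) (v x) (Icc 0 b) x :=
    intervalIntegral.integral_hasDerivWithinAt_right (hvi x hx)
      (hv.stronglyMeasurableAtFilter_nhdsWithin measurableSet_Icc x) (hv x hx)
  exact (hd.const_add (u 0)).congr hrep (hrep x hx)

/-- The derivative of `quarterSin`. -/
def quarterCos (q b x : ℝ) : ℝ := sinFreq q b * √(1 - quarterSin q b x ^ q)

theorem continuousOn_quarterSin_rpow {q b r : ℝ} (hq : 1 < q) (hb : 0 < b) (hr : 0 ≤ r) :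
    ContinuousOn (fun x => quarterSin q b x ^ r) (Icc 0 b) :=
  (continuousOn_quarterSin hq hb).rpow_const fun _ _ => Or.inr hr

theorem continuousOn_quarterCos {q b : ℝ} (hq : 1 < q) (hb : 0 < b) :
    ContinuousOn (quarterCos q b) (Icc 0 b) :=
  continuousOn_const.mul (continuousOn_const.sub
    (continuousOn_quarterSin_rpow hq hb (by linarith))).sqrt

theorem hasDerivAt_quarterSin {q b x : ℝ} (hq : 1 < q) (hb : 0 < b) (hx : x ∈ Ioo 0 b) :
    HasDerivAt (quarterSin q b) (quarterCos q b x) x := by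
  have hk := sinFreq_pos hq hb
  obtain ⟨h0, h1⟩ := quarterSin_mem_Ioo hq hb hx
  have hlt := rpow_lt_one_of_abs_lt_one (q := q) (y := quarterSin q b x) (by linarith)
    (by rw [abs_of_pos h0]; exact h1)
  have hA : HasDerivAt (fun y => arcsinPQ 2 q y / sinFreq q b)
      ((1 - quarterSin q b x ^ q) ^ (-1 / (2 : ℝ)) / sinFreq q b) (quarterSin q b x) :=
    (hasDerivAt_arcsinPQ hq (by rw [abs_of_pos h0]; exact h1)).div_const _
  have hne : (1 - quarterSin q b x ^ q) ^ (-1 / (2 : ℝ)) / sinFreq q b ≠ 0 :=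
    (div_pos (Real.rpow_pos_of_pos (by linarith) _) hk).ne'
  have hnhds : Icc 0 b ∈ nhds x := Icc_mem_nhds hx.1 hx.2
  have := hA.of_local_left_inverse ((continuousOn_quarterSin hq hb).continuousAt hnhds) hne
    (by
      filter_upwards [hnhds] with y hy
      rw [(quarterSin_spec hq hb hy).2]; field_simp)
  refine this.congr_deriv ?_
  rw [quarterCos, inv_div, Real.sqrt_eq_rpow, div_eq_mul_inv, ← Real.rpow_neg (by linarith)]
  norm_num

theorem hasDerivWithinAt_quarterSin {q b x : ℝ} (hq : 1 < q) (hb : 0 < b) (hx : x ∈ Icc 0 b) :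
    HasDerivWithinAt (quarterSin q b) (quarterCos q b x) (Icc 0 b) x :=
  hasDerivWithinAt_Icc_of_Ioo (continuousOn_quarterSin hq hb) (continuousOn_quarterCos hq hb)
    (fun _ hy => hasDerivAt_quarterSin hq hb hy) hx

theorem hasDerivAt_quarterCos {q b x : ℝ} (hq : 1 < q) (hb : 0 < b) (hx : x ∈ Ioo 0 b) :
    HasDerivAt (quarterCos q b) (-(q / 2 * sinFreq q b ^ 2) * quarterSin q b x ^ (q - 1)) x := by
  obtain ⟨h0, h1⟩ := quarterSin_mem_Ioo hq hb hx
  have hlt := rpow_lt_one_of_abs_lt_one (q := q) (y := quarterSin q b x) (by linarith)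
    (by rw [abs_of_pos h0]; exact h1)
  have hs : 0 < √(1 - quarterSin q b x ^ q) := Real.sqrt_pos.2 (by linarith)
  have h := ((((hasDerivAt_quarterSin hq hb hx).rpow_const (p := q) (Or.inl h0.ne')).const_sub
    1).sqrt (by linarith)).const_mul (sinFreq q b)
  refine h.congr_deriv ?_
  rw [quarterCos]
  field_simp

theorem hasDerivWithinAt_quarterCos {q b x : ℝ} (hq : 1 < q) (hb : 0 < b) (hx : x ∈ Icc 0 b) :
    HasDerivWithinAt (quarterCos q b)
      (-(q / 2 * sinFreq q b ^ 2) * quarterSin q b x ^ (q - 1)) (Icc 0 b) x :=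
  hasDerivWithinAt_Icc_of_Ioo (continuousOn_quarterCos hq hb)
    (continuousOn_const.mul (continuousOn_quarterSin_rpow hq hb (by linarith)))
    (fun _ hy => hasDerivAt_quarterCos hq hb hy) hx

theorem quarterCos_right {q b : ℝ} (hq : 1 < q) (hb : 0 < b) : quarterCos q b b = 0 := by
  simp [quarterCos, quarterSin_right hq hb]

theorem quarterCos_nonneg {q b x : ℝ} (hq : 1 < q) (hb : 0 < b) : 0 ≤ quarterCos q b x :=
  mul_nonneg (sinFreq_pos hq hb).le (Real.sqrt_nonneg _)

/-- With S the sine, (S S')' = S'² + S S'' = k² (1 - (1 + q/2) S^q), and S S' vanishes at both ends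
because S(0) = 0 and S'(b) = 0. -/
theorem integral_quarterSin_rpow {q b : ℝ} (hq : 1 < q) (hb : 0 < b) :
    ∫ x in (0 : ℝ)..b, quarterSin q b x ^ q = 2 * b / (q + 2) := by
  have hk := sinFreq_pos hq hb
  have hI := intervalIntegral.integral_deriv_mul_eq_sub_of_hasDerivWithinAt (a := 0) (b := b)
    (u := quarterSin q b) (v := quarterCos q b) (u' := quarterCos q b)
    (v' := fun x => -(q / 2 * sinFreq q b ^ 2) * quarterSin q b x ^ (q - 1))
    (by rw [uIcc_of_le hb.le]; exact fun x hx => hasDerivWithinAt_quarterSin hq hb hx)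
    (by rw [uIcc_of_le hb.le]; exact fun x hx => hasDerivWithinAt_quarterCos hq hb hx)
    (ContinuousOn.intervalIntegrable (by
      rw [uIcc_of_le hb.le]; exact continuousOn_quarterCos hq hb))
    (ContinuousOn.intervalIntegrable (by
      rw [uIcc_of_le hb.le]
      exact continuousOn_const.mul (continuousOn_quarterSin_rpow hq hb (by linarith))))
  have hpt : ∫ x in (0 : ℝ)..b, (quarterCos q b x * quarterCos q b x + quarterSin q b x *
      (-(q / 2 * sinFreq q b ^ 2) * quarterSin q b x ^ (q - 1))) =
      ∫ x in (0 : ℝ)..b, sinFreq q b ^ 2 * (1 - (1 + q / 2) * quarterSin q b x ^ q) := by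
    refine intervalIntegral.integral_congr fun x hx => ?_
    rw [uIcc_of_le hb.le] at hx
    obtain ⟨⟨h0, h1⟩, -⟩ := quarterSin_spec hq hb hx
    have h2 : quarterSin q b x ^ q ≤ 1 := Real.rpow_le_one h0 h1 (by linarith)
    have h3 : quarterSin q b x * quarterSin q b x ^ (q - 1) = quarterSin q b x ^ q := by
      rw [mul_comm, ← Real.rpow_add_one' h0 (by linarith)]; ring_nf
    have h4 := Real.mul_self_sqrt (show 0 ≤ 1 - quarterSin q b x ^ q by linarith)
    simp only [quarterCos]
    linear_combination sinFreq q b ^ 2 * h4 - q / 2 * sinFreq q b ^ 2 * h3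
  have hint : IntervalIntegrable (fun x => quarterSin q b x ^ q) volume 0 b :=
    ContinuousOn.intervalIntegrable (by
      rw [uIcc_of_le hb.le]; exact continuousOn_quarterSin_rpow hq hb (by linarith))
  rw [hpt, quarterCos_right hq hb, quarterSin_zero hq hb, intervalIntegral.integral_const_mul,
    intervalIntegral.integral_sub (by simp) (hint.const_mul _),
    intervalIntegral.integral_const_mul] at hI
  simp only [intervalIntegral.integral_const, smul_eq_mul, sub_zero, mul_one, mul_zero, zero_mul,
    mul_eq_zero, pow_eq_zero_iff, ne_eq, OfNat.ofNat_ne_zero, not_false_eq_true, hk.ne',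
    false_or] at hI
  rw [eq_div_iff (by linarith)]
  linarith

/-- The substitution y = S(x) turns the integrand into k (1 - S^q), whose integral is already known.
-/
theorem integral_sqrt_one_sub_rpow {q b : ℝ} (hq : 1 < q) (hb : 0 < b) :
    ∫ y in (0 : ℝ)..1, √(1 - y ^ q) = sinFreq q b * b * q / (q + 2) := by
  have h := intervalIntegral.integral_comp_mul_deriv_of_deriv_nonneg (a := 0) (b := b)
    (f := quarterSin q b) (f' := quarterCos q b) (g := fun y => √(1 - y ^ q))
    (by rw [uIcc_of_le hb.le]; exact continuousOn_quarterSin hq hb)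
    (by rw [min_eq_left hb.le, max_eq_right hb.le]
        exact fun x hx => hasDerivAt_quarterSin hq hb hx)
    (fun x _ => quarterCos_nonneg hq hb)
  rw [quarterSin_zero hq hb, quarterSin_right hq hb] at h
  have hint : IntervalIntegrable (fun x => quarterSin q b x ^ q) volume 0 b :=
    ContinuousOn.intervalIntegrable (by
      rw [uIcc_of_le hb.le]; exact continuousOn_quarterSin_rpow hq hb (by linarith))
  rw [← h]
  have hpt : ∫ x in (0 : ℝ)..b, ((fun y => √(1 - y ^ q)) ∘ quarterSin q b) x * quarterCos q b x =
      ∫ x in (0 : ℝ)..b, sinFreq q b * (1 - quarterSin q b x ^ q) := by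
    refine intervalIntegral.integral_congr fun x hx => ?_
    rw [uIcc_of_le hb.le] at hx
    obtain ⟨⟨h0, h1⟩, -⟩ := quarterSin_spec hq hb hx
    have h2 : quarterSin q b x ^ q ≤ 1 := Real.rpow_le_one h0 h1 (by linarith)
    have h4 := Real.mul_self_sqrt (show 0 ≤ 1 - quarterSin q b x ^ q by linarith)
    simp only [quarterCos, Function.comp]
    linear_combination sinFreq q b * h4
  rw [hpt, intervalIntegral.integral_const_mul, intervalIntegral.integral_sub (by simp) hint,
    integral_quarterSin_rpow hq hb]
  have : q + 2 ≠ 0 := by linarith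
  simp
  field_simp
  ring

/-! ### The sharp Sobolev inequality with one free end. -/

theorem eqOn_zero_of_integral_eq_zero {a b : ℝ} {f : ℝ → ℝ} (hab : a < b)
    (hf : ContinuousOn f (Icc a b)) (h0 : ∀ x ∈ Icc a b, 0 ≤ f x)
    (h : ∫ x in a..b, f x = 0) {x : ℝ} (hx : x ∈ Icc a b) : f x = 0 := by
  by_contra hne
  exact (intervalIntegral.integral_pos hab hf (fun y hy => h0 y (Ioc_subset_Icc_self hy))
    ⟨x, hx, lt_of_le_of_ne (h0 x hx) (Ne.symm hne)⟩).ne' h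

/-- Combine M^(-q) ≥ 1 - q log M with log M < M - 1. This scalar inequality fixes the maximum of an
optimal function. -/
theorem one_add_lt_mul_add_rpow_neg {q M : ℝ} (hq : 0 < q) (hM : 0 < M) (h1 : M ≠ 1) :
    q + 1 < q * M + M ^ (-q) := by
  have h2 := Real.log_lt_sub_one_of_pos hM h1
  have h3 := Real.add_one_le_exp (Real.log M * (-q))
  rw [← Real.rpow_def_of_pos hM] at h3
  nlinarith

/-- While w < 1, the arcsine of w has constant derivative k, so w agrees with the sine S. Where w =
1 one only has S ≤ w, as the arcsine is singular there; the equal integrals of the q-th powers then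
exclude any gap. -/
theorem eq_quarterSin_of_deriv_eq {q b : ℝ} {w w' : ℝ → ℝ} (hq : 1 < q) (hb : 0 < b)
    (hw : ∀ x ∈ Icc 0 b, HasDerivWithinAt w (w' x) (Icc 0 b) x) (h0 : w 0 = 0)
    (hle : ∀ x ∈ Icc 0 b, |w x| ≤ 1)
    (hode : ∀ x ∈ Icc 0 b, w' x = sinFreq q b * √(1 - |w x| ^ q))
    (hN : ∫ x in (0 : ℝ)..b, |w x| ^ q = 2 * b / (q + 2)) {x : ℝ} (hx : x ∈ Icc 0 b) :
    w x = quarterSin q b x := by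
  have hk := sinFreq_pos hq hb
  have hwc : ContinuousOn w (Icc 0 b) := fun x hx => (hw x hx).continuousWithinAt
  have hwd : ∀ x ∈ Ioo 0 b, HasDerivAt w (w' x) x := fun x hx =>
    (hw x (Ioo_subset_Icc_self hx)).hasDerivAt (Icc_mem_nhds hx.1 hx.2)
  have hmono : MonotoneOn w (Icc 0 b) := by
    refine monotoneOn_of_deriv_nonneg (convex_Icc 0 b) hwc (fun x hx => ?_) (fun x hx => ?_) <;>
      rw [interior_Icc] at hx
    · exact (hwd x hx).differentiableAt.differentiableWithinAt
    · rw [(hwd x hx).deriv, hode x (Ioo_subset_Icc_self hx)]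
      positivity
  have hnn : ∀ x ∈ Icc 0 b, 0 ≤ w x := fun x hx => by
    simpa [h0] using hmono (left_mem_Icc.2 hb.le) hx hx.1
  have hlt : ∀ x ∈ Icc 0 b, w x < 1 → w x = quarterSin q b x := by
    intro x hx hx1
    have hw1 : ∀ y ∈ Icc 0 x, w y ∈ Icc 0 1 ∧ w y < 1 := fun y hy => by
      have hy' : y ∈ Icc 0 b := ⟨hy.1, hy.2.trans hx.2⟩
      have := (hmono hy' hx hy.2).trans_lt hx1
      exact ⟨⟨hnn y hy', this.le⟩, this⟩
    refine eq_quarterSin hq hb hx (hw1 x (right_mem_Icc.2 hx.1)).1 ?_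
    have := intervalIntegral.integral_eq_sub_of_hasDerivAt_of_le (a := 0) (b := x)
      (f := fun y => arcsinPQ 2 q (w y)) (f' := fun _ => sinFreq q b) hx.1
      ((continuousOn_arcsinPQ hq).comp (hwc.mono (Icc_subset_Icc_right hx.2))
        fun y hy => (hw1 y hy).1)
      (fun y hy => by
        obtain ⟨⟨h2, h3⟩, h4⟩ := hw1 y (Ioo_subset_Icc_self hy)
        have hy' : y ∈ Ioo 0 b := ⟨hy.1, hy.2.trans_le hx.2⟩
        have habs : |w y| < 1 := by rwa [abs_of_nonneg h2]
        refine ((hasDerivAt_arcsinPQ hq habs).comp y (hwd y hy')).congr_deriv ?_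
        rw [hode y (Ioo_subset_Icc_self hy'), abs_of_nonneg h2, Real.sqrt_eq_rpow, mul_left_comm,
          ← Real.rpow_add (by linarith [rpow_lt_one_of_abs_lt_one (q := q) (by linarith) habs])]
        norm_num)
      (by simp)
    rw [h0, arcsinPQ_zero] at this
    simp at this
    linarith
  have hge : ∀ x ∈ Icc 0 b, quarterSin q b x ≤ w x := fun x hx => by
    rcases ((le_abs_self _).trans (hle x hx)).lt_or_eq with h | h
    · exact (hlt x hx h).ge
    · rw [h]; exact (quarterSin_spec hq hb hx).1.2
  have hcw : ContinuousOn (fun x => |w x| ^ q) (Icc 0 b) :=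
    hwc.abs.rpow_const fun _ _ => Or.inr (by linarith)
  have hcS := continuousOn_quarterSin_rpow (r := q) hq hb (by linarith)
  have hi : ∀ f : ℝ → ℝ, ContinuousOn f (Icc 0 b) → IntervalIntegrable f volume 0 b :=
    fun f hf => ContinuousOn.intervalIntegrable (by rwa [uIcc_of_le hb.le])
  have hz := eqOn_zero_of_integral_eq_zero (f := fun x => |w x| ^ q - quarterSin q b x ^ q) hb
    (hcw.sub hcS) (fun x hx => by
      rw [abs_of_nonneg (hnn x hx), sub_nonneg]
      exact Real.rpow_le_rpow (quarterSin_spec hq hb hx).1.1 (hge x hx) (by linarith))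
    (by rw [intervalIntegral.integral_sub (hi _ hcw) (hi _ hcS), hN,
      integral_quarterSin_rpow hq hb, sub_self]) hx
  rw [abs_of_nonneg (hnn x hx), sub_eq_zero] at hz
  exact (Real.rpow_left_inj (hnn x hx) (quarterSin_spec hq hb hx).1.1 (by linarith)).1 hz

/-- The calibration argument. Here s(w)² = k² D(w), and the remainders `r₁` = (w' - s(w))² and `r₂`
= w'² + s(w)² measure the loss before and after the maximum point. -/
theorem energy_lower_bound_of_max {q b M x₀ : ℝ} {w w' : ℝ → ℝ} (hq : 1 < q) (hb : 0 < b)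
    (hw : ∀ x ∈ Icc 0 b, HasDerivWithinAt w (w' x) (Icc 0 b) x)
    (hw'c : ContinuousOn w' (Icc 0 b)) (h0 : w 0 = 0)
    (hN : ∫ x in (0 : ℝ)..b, |w x| ^ q = 2 * b / (q + 2))
    (hx₀ : x₀ ∈ Icc 0 b) (hM : 0 < M) (hwx₀ : w x₀ = M) (hmax : ∀ x ∈ Icc 0 b, |w x| ≤ M) :
    sinFreq q b ^ 2 * b * q / (q + 2) ≤ ∫ x in (0 : ℝ)..b, w' x ^ 2 ∧
    (∫ x in (0 : ℝ)..b, w' x ^ 2 = sinFreq q b ^ 2 * b * q / (q + 2) →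
      ∀ x ∈ Icc 0 b, w x = quarterSin q b x) := by
  have hk := sinFreq_pos hq hb
  set k := sinFreq q b with hkdef
  have hwc : ContinuousOn w (Icc 0 b) := fun x hx => (hw x hx).continuousWithinAt
  have hx0 : 0 < x₀ := lt_of_le_of_ne hx₀.1 fun h => by
    rw [← h, h0] at hwx₀; exact hM.ne hwx₀
  have hs1 : Icc 0 x₀ ⊆ Icc 0 b := Icc_subset_Icc_right hx₀.2
  have hs2 : Icc x₀ b ⊆ Icc 0 b := Icc_subset_Icc_left hx₀.1
  let D : ℝ → ℝ := fun y => 1 - (|y| / M) ^ q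
  have hDc : Continuous D := continuous_const.sub
    ((continuous_abs.div_const M).rpow_const fun _ => Or.inr (by linarith))
  let s : ℝ → ℝ := fun y => k * √(D y)
  have hsc : Continuous s := continuous_const.mul hDc.sqrt
  have hDnn : ∀ x ∈ Icc 0 b, 0 ≤ D (w x) := fun x hx => by
    have : (|w x| / M) ^ q ≤ 1 :=
      Real.rpow_le_one (by positivity) ((div_le_one hM).2 (hmax x hx)) (by linarith)
    simp only [D]; linarith
  have hssq : ∀ x ∈ Icc 0 b, s (w x) ^ 2 = k ^ 2 * D (w x) := fun x hx => by
    rw [mul_pow, Real.sq_sqrt (hDnn x hx)]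
  have hcD : ContinuousOn (fun x => D (w x)) (Icc 0 b) := hDc.comp_continuousOn hwc
  have hcs : ContinuousOn (fun x => s (w x)) (Icc 0 b) := hsc.comp_continuousOn hwc
  have hint : ∀ f : ℝ → ℝ, ContinuousOn f (Icc 0 b) → ∀ y ∈ Icc 0 b, ∀ z ∈ Icc 0 b,
      IntervalIntegrable f volume y z := fun f hf y hy z hz =>
    (hf.mono (uIcc_subset_Icc hy hz)).intervalIntegrable
  have hl : (0 : ℝ) ∈ Icc 0 b := left_mem_Icc.2 hb.le
  have hr : b ∈ Icc 0 b := right_mem_Icc.2 hb.le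
  -- Substituting y = w(x) needs no monotonicity of w: only the end values 0 and M enter.
  have hsub : ∫ x in (0 : ℝ)..x₀, s (w x) * w' x = k * M * (k * b * q / (q + 2)) := by
    have h1 := intervalIntegral.integral_comp_mul_deriv'' (a := 0) (b := x₀) (f := w) (f' := w')
      (g := s) (by rw [uIcc_of_le hx0.le]; exact hwc.mono hs1)
      (by
        rw [min_eq_left hx0.le, max_eq_right hx0.le]
        intro x hx
        exact ((hw x (hs1 (Ioo_subset_Icc_self hx))).hasDerivAt
          (Icc_mem_nhds hx.1 (hx.2.trans_le hx₀.2))).hasDerivWithinAt)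
      (by rw [uIcc_of_le hx0.le]; exact hw'c.mono hs1) hsc.continuousOn
    rw [h0, hwx₀] at h1
    change ∫ x in (0 : ℝ)..x₀, s (w x) * w' x = _ at h1
    rw [h1]
    have h2 : ∫ y in (0 : ℝ)..M, s y = ∫ y in (0 : ℝ)..M, (fun z => k * √(1 - z ^ q)) (y / M) := by
      refine intervalIntegral.integral_congr fun y hy => ?_
      rw [uIcc_of_le hM.le] at hy
      simp only [s, D, abs_of_nonneg hy.1]
    rw [h2, intervalIntegral.integral_comp_div (fun z => k * √(1 - z ^ q)) hM.ne',
      zero_div, div_self hM.ne', intervalIntegral.integral_const_mul, integral_sqrt_one_sub_rpow hq hb, smul_eq_mul]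
    ring
  have hDint : ∫ x in (0 : ℝ)..b, D (w x) = b - 2 * b / (q + 2) * M ^ (-q) := by
    have : ∫ x in (0 : ℝ)..b, D (w x) = ∫ x in (0 : ℝ)..b, (1 - |w x| ^ q * M ^ (-q)) := by
      refine intervalIntegral.integral_congr fun x _ => ?_
      simp only [D]
      rw [Real.div_rpow (abs_nonneg _) hM.le, Real.rpow_neg hM.le, div_eq_mul_inv]
    rw [this, intervalIntegral.integral_sub (by simp) ((hint _ (hwc.abs.rpow_const fun _ _ =>
      Or.inr (by linarith)) _ hl _ hr).mul_const _), intervalIntegral.integral_mul_const, hN]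
    simp
  have hw2 : ContinuousOn (fun x => w' x ^ 2) (Icc 0 b) := hw'c.pow 2
  have hcsw : ContinuousOn (fun x => s (w x) * w' x) (Icc 0 b) := hcs.mul hw'c
  let r₁ : ℝ → ℝ := fun x => (w' x - s (w x)) ^ 2
  let r₂ : ℝ → ℝ := fun x => w' x ^ 2 + k ^ 2 * D (w x)
  have hr1c : ContinuousOn r₁ (Icc 0 b) := (hw'c.sub hcs).pow 2
  have hr2c : ContinuousOn r₂ (Icc 0 b) := hw2.add (continuousOn_const.mul hcD)
  have hr1 : 0 ≤ ∫ x in (0 : ℝ)..x₀, r₁ x :=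
    intervalIntegral.integral_nonneg hx0.le fun x _ => sq_nonneg _
  have hr2nn : ∀ x ∈ Icc 0 b, 0 ≤ r₂ x := fun x hx => by
    have := hDnn x hx
    simp only [r₂]; positivity
  have hr2 : 0 ≤ ∫ x in x₀..b, r₂ x :=
    intervalIntegral.integral_nonneg hx₀.2 fun x hx => hr2nn x (hs2 hx)
  have hE1 : ∫ x in (0 : ℝ)..x₀, w' x ^ 2 = (∫ x in (0 : ℝ)..x₀, r₁ x) +
      2 * (∫ x in (0 : ℝ)..x₀, s (w x) * w' x) - k ^ 2 * ∫ x in (0 : ℝ)..x₀, D (w x) := by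
    rw [← intervalIntegral.integral_const_mul, ← intervalIntegral.integral_const_mul,
      ← intervalIntegral.integral_add (hint _ hr1c _ hl _ hx₀)
        ((hint _ hcsw _ hl _ hx₀).const_mul _),
      ← intervalIntegral.integral_sub ((hint _ hr1c _ hl _ hx₀).add
        ((hint _ hcsw _ hl _ hx₀).const_mul _)) ((hint _ hcD _ hl _ hx₀).const_mul _)]
    refine intervalIntegral.integral_congr fun x hx => ?_
    rw [uIcc_of_le hx0.le] at hx
    simp only [r₁, ← hssq x (hs1 hx)]
    ring
  have hE2 : ∫ x in x₀..b, w' x ^ 2 = (∫ x in x₀..b, r₂ x) - k ^ 2 * ∫ x in x₀..b, D (w x) := by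
    rw [← intervalIntegral.integral_const_mul,
      ← intervalIntegral.integral_sub (hint _ hr2c _ hx₀ _ hr)
        ((hint _ hcD _ hx₀ _ hr).const_mul _)]
    refine intervalIntegral.integral_congr fun x hx => ?_
    simp only [r₂]
    ring
  -- An exact identity: the energy is the optimal value plus three nonnegative terms, so it yields
  -- both the bound and the equality case.
  have hE : ∫ x in (0 : ℝ)..b, w' x ^ 2 = (∫ x in (0 : ℝ)..x₀, r₁ x) + (∫ x in x₀..b, r₂ x) +
      2 * (k ^ 2 * b / (q + 2)) * (q * M + M ^ (-q) - (q + 1)) + k ^ 2 * b * q / (q + 2) := by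
    rw [← intervalIntegral.integral_add_adjacent_intervals (hint _ hw2 _ hl _ hx₀)
      (hint _ hw2 _ hx₀ _ hr), hE1, hE2, hsub]
    rw [← intervalIntegral.integral_add_adjacent_intervals (hint _ hcD _ hl _ hx₀)
      (hint _ hcD _ hx₀ _ hr)] at hDint
    have : q + 2 ≠ 0 := by linarith
    field_simp
    field_simp at hDint
    linear_combination (-k ^ 2) * hDint
  have hc : 0 < 2 * (k ^ 2 * b / (q + 2)) := by
    have : 0 < q + 2 := by linarith
    positivity
  have hMle : 0 ≤ q * M + M ^ (-q) - (q + 1) := by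
    rcases eq_or_ne M 1 with h | h
    · simp [h]
    · linarith [one_add_lt_mul_add_rpow_neg (q := q) (by linarith) hM h]
  refine ⟨by rw [hE]; nlinarith [mul_nonneg hc.le hMle], fun heq => ?_⟩
  rw [hE] at heq
  have hcM := mul_nonneg hc.le hMle
  have hM1 : M = 1 := by
    by_contra h
    have := mul_pos hc (sub_pos.2 (one_add_lt_mul_add_rpow_neg (q := q) (by linarith) hM h))
    linarith
  have hr1z : ∫ x in (0 : ℝ)..x₀, r₁ x = 0 := by linarith
  have hr2z : ∫ x in x₀..b, r₂ x = 0 := by linarith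
  have hode1 : ∀ x ∈ Icc 0 x₀, w' x = s (w x) := fun x hx => by
    have := eqOn_zero_of_integral_eq_zero hx0 (hr1c.mono hs1) (fun x _ => sq_nonneg _) hr1z hx
    exact sub_eq_zero.1 (pow_eq_zero_iff two_ne_zero |>.1 this)
  have hode : ∀ x ∈ Icc 0 b, w' x = s (w x) := by
    intro x hx
    rcases le_or_gt x x₀ with h | h
    · exact hode1 x ⟨hx.1, h⟩
    · have hxb : x ∈ Icc x₀ b := ⟨h.le, hx.2⟩
      have := eqOn_zero_of_integral_eq_zero (h.trans_le hx.2) (hr2c.mono hs2)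
        (fun x hx => hr2nn x (hs2 hx)) hr2z hxb
      have h1 := hDnn x hx
      have h2 : 0 ≤ k ^ 2 * D (w x) := by positivity
      have h3 : w' x ^ 2 = 0 := by simp only [r₂] at this; nlinarith [sq_nonneg (w' x)]
      have h4 : s (w x) ^ 2 = 0 := by
        rw [hssq x hx]; simp only [r₂] at this; nlinarith [sq_nonneg (w' x)]
      rw [pow_eq_zero_iff two_ne_zero] at h3 h4
      -- After x₀ both summands of `r₂` vanish, so the first-order equation holds there as 0 = 0.
      rw [h3, h4]
  subst hM1
  exact fun x hx => eq_quarterSin_of_deriv_eq hq hb hw h0 hmax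
    (fun x hx => by simpa [s, D] using hode x hx) hN hx

theorem energy_lower_bound {q b : ℝ} {w w' : ℝ → ℝ} (hq : 1 < q) (hb : 0 < b)
    (hw : ∀ x ∈ Icc 0 b, HasDerivWithinAt w (w' x) (Icc 0 b) x)
    (hw'c : ContinuousOn w' (Icc 0 b)) (h0 : w 0 = 0)
    (hN : ∫ x in (0 : ℝ)..b, |w x| ^ q = 2 * b / (q + 2)) :
    sinFreq q b ^ 2 * b * q / (q + 2) ≤ ∫ x in (0 : ℝ)..b, w' x ^ 2 ∧
    (∫ x in (0 : ℝ)..b, w' x ^ 2 = sinFreq q b ^ 2 * b * q / (q + 2) →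
      ∃ c : ℝ, c ≠ 0 ∧ ∀ x ∈ Icc 0 b, w x = c * quarterSin q b x) := by
  have hwc : ContinuousOn w (Icc 0 b) := fun x hx => (hw x hx).continuousWithinAt
  obtain ⟨x₀, hx₀, hmax⟩ := isCompact_Icc.exists_isMaxOn (nonempty_Icc.2 hb.le) hwc.abs
  have hmax' : ∀ x ∈ Icc 0 b, |w x| ≤ |w x₀| := fun x hx => hmax hx
  have hM : 0 < |w x₀| := by
    refine lt_of_le_of_ne (abs_nonneg _) fun h => ?_
    have h1 : ∫ x in (0 : ℝ)..b, |w x| ^ q = ∫ x in (0 : ℝ)..b, (0 : ℝ) := by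
      refine intervalIntegral.integral_congr fun x hx => ?_
      rw [uIcc_of_le hb.le] at hx
      have h2 : |w x| = 0 := le_antisymm ((hmax' x hx).trans h.ge) (abs_nonneg _)
      simp only [h2, Real.zero_rpow (show q ≠ 0 by linarith)]
    rw [h1, intervalIntegral.integral_zero] at hN
    have : 0 < 2 * b / (q + 2) := by
      have : 0 < q + 2 := by linarith
      positivity
    exact this.ne hN
  rcases abs_choice (w x₀) with h | h
  · obtain ⟨h1, h2⟩ := energy_lower_bound_of_max hq hb hw hw'c h0 hN hx₀ hM h.symm hmax'
    exact ⟨h1, fun he => ⟨1, one_ne_zero, fun x hx => by rw [one_mul]; exact h2 he x hx⟩⟩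
  · obtain ⟨h1, h2⟩ := energy_lower_bound_of_max (w := fun x => -w x) (w' := fun x => -w' x) hq hb
      (fun x hx => (hw x hx).neg) hw'c.neg (by simp [h0]) (by simpa using hN) hx₀ hM h.symm
      (by simpa using hmax')
    simp only [neg_sq] at h1 h2
    exact ⟨h1, fun he => ⟨-1, by norm_num, fun x hx => by linarith [h2 he x hx]⟩⟩

/-- The sharp constant: the norm of `H^* H`. -/
def sharpConst (q b : ℝ) : ℝ :=
  2 / (q * sinFreq q b ^ 2) * (2 * b / (q + 2)) ^ (2 / q - 1)

theorem sharpConst_pos {q b : ℝ} (hq : 1 < q) (hb : 0 < b) : 0 < sharpConst q b := by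
  have := sinFreq_pos hq hb
  have : 0 < q + 2 := by linarith
  rw [sharpConst]
  positivity

/-- The constant is N^(2/q) / E, with N = 2b/(q+2) the integral of S^q and E = k² b q/(q+2) the
energy of S. -/
theorem sharpConst_mul {q b : ℝ} (hq : 1 < q) (hb : 0 < b) :
    sharpConst q b * (sinFreq q b ^ 2 * b * q / (q + 2)) = (2 * b / (q + 2)) ^ (2 / q) := by
  have hk := sinFreq_pos hq hb
  have h2 : 0 < q + 2 := by linarith
  rw [sharpConst, Real.rpow_sub_one (by positivity)]
  field_simp

theorem sobolev_quarter {q b : ℝ} {w w' : ℝ → ℝ} (hq : 1 < q) (hb : 0 < b)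
    (hw : ∀ x ∈ Icc 0 b, HasDerivWithinAt w (w' x) (Icc 0 b) x)
    (hw'c : ContinuousOn w' (Icc 0 b)) (h0 : w 0 = 0)
    (hN : 0 < ∫ x in (0 : ℝ)..b, |w x| ^ q) :
    (∫ x in (0 : ℝ)..b, |w x| ^ q) ^ (2 / q) ≤ sharpConst q b * ∫ x in (0 : ℝ)..b, w' x ^ 2 ∧
    ((∫ x in (0 : ℝ)..b, |w x| ^ q) ^ (2 / q) = sharpConst q b * ∫ x in (0 : ℝ)..b, w' x ^ 2 →
      ∃ c : ℝ, c ≠ 0 ∧ ∀ x ∈ Icc 0 b, w x = c * quarterSin q b x) := by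
  have h2 : 0 < q + 2 := by linarith
  have hq0 : 0 < q := by linarith
  have hC := sharpConst_pos hq hb
  set N := ∫ x in (0 : ℝ)..b, |w x| ^ q with hNdef
  have hn : 0 < 2 * b / (q + 2) := by positivity
  -- The factor that scales w to the integral of S^q; both sides of the claim are homogeneous of
  -- degree 2 in w.
  set t := (2 * b / (q + 2) / N) ^ (1 / q) with ht
  have htp : 0 < t := by positivity
  have htq : t ^ q = 2 * b / (q + 2) / N := by
    rw [ht, ← Real.rpow_mul (by positivity), one_div_mul_cancel hq0.ne', Real.rpow_one]
  have ht2 : t ^ 2 * N ^ (2 / q) = (2 * b / (q + 2)) ^ (2 / q) := by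
    have h3 : t ^ 2 = (2 * b / (q + 2) / N) ^ (2 / q) := by
      rw [ht, ← Real.rpow_natCast, ← Real.rpow_mul (by positivity)]
      congr 1
      push_cast
      ring
    rw [h3, ← Real.mul_rpow (by positivity) hN.le, div_mul_cancel₀ _ hN.ne']
  obtain ⟨h3, h4⟩ := energy_lower_bound (w := fun x => t * w x) (w' := fun x => t * w' x) hq hb
    (fun x hx => (hw x hx).const_mul t) (continuousOn_const.mul hw'c) (by simp [h0]) (by
      simp only [abs_mul, abs_of_pos htp, Real.mul_rpow htp.le (abs_nonneg _)]
      rw [intervalIntegral.integral_const_mul, htq, ← hNdef, div_mul_cancel₀ _ hN.ne'])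
  simp only [mul_pow, intervalIntegral.integral_const_mul] at h3 h4
  have hCm := sharpConst_mul hq hb
  have ht2p : 0 < t ^ 2 := by positivity
  refine ⟨?_, fun he => ?_⟩
  · rw [← mul_le_mul_iff_of_pos_left ht2p, ht2, ← hCm, mul_left_comm]
    exact mul_le_mul_of_nonneg_left h3 hC.le
  · obtain ⟨c, hc, h5⟩ := h4 (by
      rw [← mul_right_inj' hC.ne', hCm, ← ht2, he, mul_left_comm])
    refine ⟨c / t, div_ne_zero hc htp.ne', fun x hx => ?_⟩
    rw [div_mul_eq_mul_div, eq_div_iff htp.ne', ← h5 x hx, mul_comm]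

/-! ### The constant in terms of the beta function. -/

theorem beta_eq_integral {α β : ℝ} (hα : 0 < α) (hβ : 0 < β) :
    ProbabilityTheory.beta α β = ∫ x in (0 : ℝ)..1, x ^ (α - 1) * (1 - x) ^ (β - 1) := by
  rw [ProbabilityTheory.beta_eq_betaIntegralReal α β hα hβ, Complex.betaIntegral]
  have : ∫ x in (0 : ℝ)..1, (x : ℂ) ^ ((α : ℂ) - 1) * (1 - (x : ℂ)) ^ ((β : ℂ) - 1) =
      ∫ x in (0 : ℝ)..1, ((x ^ (α - 1) * (1 - x) ^ (β - 1) : ℝ) : ℂ) := by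
    refine intervalIntegral.integral_congr fun x hx => ?_
    rw [uIcc_of_le zero_le_one] at hx
    simp only [Complex.ofReal_mul]
    rw [Complex.ofReal_cpow hx.1, Complex.ofReal_cpow (by linarith [hx.2])]
    push_cast
    rfl
  rw [this, intervalIntegral.integral_ofReal, Complex.ofReal_re]

theorem arcsinPQ_one_eq_beta {q : ℝ} (hq : 1 < q) :
    arcsinPQ 2 q 1 = ProbabilityTheory.beta (1 / q) (1 / 2) / q := by
  have hq0 : 0 < q := by linarith
  -- The substitution x ↦ x^q is taken on the half-line, so the beta integrand is cut off by an
  -- indicator of (0, 1].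
  have h := integral_comp_rpow_Ioi_of_pos (p := q) hq0
    (g := (Ioc (0 : ℝ) 1).indicator fun x : ℝ => x ^ (1 / q - 1) * (1 - x) ^ (1 / 2 - 1 : ℝ))
  have hI : Ioi (0 : ℝ) ∩ Ioc 0 1 = Ioc 0 1 := inter_eq_right.2 fun x hx => hx.1
  rw [setIntegral_indicator measurableSet_Ioc, hI,
    ← intervalIntegral.integral_of_le zero_le_one, ← beta_eq_integral (by positivity) (by norm_num)]
    at h
  rw [← h, eq_div_iff hq0.ne', arcsinPQ, mul_comm, ← intervalIntegral.integral_const_mul,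
    intervalIntegral.integral_of_le zero_le_one]
  conv_lhs => rw [← hI, ← setIntegral_indicator measurableSet_Ioc]
  refine setIntegral_congr_fun measurableSet_Ioi fun x hx => ?_
  have hx0 : 0 < x := hx
  by_cases h1 : x ≤ 1
  · have h2 : x ^ q ∈ Ioc (0 : ℝ) 1 :=
      ⟨Real.rpow_pos_of_pos hx0 _, Real.rpow_le_one hx0.le h1 hq0.le⟩
    have h3 : x ^ (q - 1) * (x ^ q) ^ (1 / q - 1) = 1 := by
      rw [← Real.rpow_mul hx0.le, ← Real.rpow_add hx0]
      have : q - 1 + q * (1 / q - 1) = 0 := by field_simp; ring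
      rw [this, Real.rpow_zero]
    simp only [smul_eq_mul]
    rw [indicator_of_mem (show x ∈ Ioc (0 : ℝ) 1 from ⟨hx0, h1⟩), indicator_of_mem h2,
      show (1 / 2 - 1 : ℝ) = -1 / 2 by norm_num]
    linear_combination (-q * (1 - x ^ q) ^ (-1 / 2 : ℝ)) * h3
  · have h2 : x ^ q ∉ Ioc (0 : ℝ) 1 := fun h => by
      have := Real.one_lt_rpow (not_le.1 h1) hq0
      exact this.not_ge h.2
    simp only [smul_eq_mul]
    rw [indicator_of_notMem (fun h : x ∈ Ioc (0 : ℝ) 1 => h1 h.2), indicator_of_notMem h2, mul_zero]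

theorem sharpConst_eq_beta {q b : ℝ} (hq : 1 < q) (hb : 0 < b) :
    sharpConst q b = b ^ (1 + 2 / q) * (q + 2) ^ (1 - 2 / q) * q * 2 ^ (2 / q)
        / (ProbabilityTheory.beta (1 / q) (1 / 2)) ^ 2 := by
  have hq0 : 0 < q := by linarith
  have hB : 0 < ProbabilityTheory.beta (1 / q) (1 / 2) :=
    ProbabilityTheory.beta_pos (by positivity) (by norm_num)
  set B := ProbabilityTheory.beta (1 / q) (1 / 2)
  have hk : sinFreq q b = B / (q * b) := by
    have := sinFreq_mul (q := q) hb
    rw [arcsinPQ_one_eq_beta hq] at this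
    rw [eq_div_iff (by positivity)]
    field_simp at this
    linarith
  rw [sharpConst, hk, Real.div_rpow (by positivity) (by positivity),
    Real.mul_rpow (by norm_num) hb.le, show (1 : ℝ) - 2 / q = -(2 / q - 1) by ring,
    Real.rpow_neg (by positivity), Real.rpow_sub_one two_ne_zero, Real.rpow_sub_one hb.ne',
    Real.rpow_add hb, Real.rpow_one]
  have : (q + 2) ^ (2 / q - 1) ≠ 0 := (Real.rpow_pos_of_pos (by positivity) _).ne'
  field_simp

/-! ### Duality of the Hardy operators, norms and Hölder's inequality. -/

/-- Integration by parts for absolutely continuous primitives; one vanishes at 0 and the other at b,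
so there is no boundary term. -/
theorem integral_primitive_mul {b : ℝ} {f g : ℝ → ℝ} (hf : IntervalIntegrable f volume 0 b)
    (hg : IntervalIntegrable g volume 0 b) :
    ∫ x in (0 : ℝ)..b, (∫ t in (0 : ℝ)..x, f t) * g x =
      ∫ x in (0 : ℝ)..b, f x * ∫ t in x..b, g t := by
  have hF := hf.absolutelyContinuousOnInterval_intervalIntegral (c := 0) left_mem_uIcc
  have hG := hg.absolutelyContinuousOnInterval_intervalIntegral (c := b) right_mem_uIcc
  have h := hF.integral_deriv_mul_eq_sub hG
  simp only [intervalIntegral.integral_same, mul_zero, zero_mul, sub_zero] at h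
  have h2 : ∫ x in (0 : ℝ)..b, (deriv (fun x => ∫ t in (0 : ℝ)..x, f t) x * (∫ t in b..x, g t) +
      (∫ t in (0 : ℝ)..x, f t) * deriv (fun x => ∫ t in b..x, g t) x) =
      ∫ x in (0 : ℝ)..b, ((∫ t in (0 : ℝ)..x, f t) * g x - f x * ∫ t in x..b, g t) := by
    refine intervalIntegral.integral_congr_ae ?_
    filter_upwards [hf.ae_hasDerivAt_integral, hg.ae_hasDerivAt_integral] with x h3 h4 hx
    have hx' := uIoc_subset_uIcc hx
    rw [(h3 hx' 0 left_mem_uIcc).deriv, (h4 hx' b right_mem_uIcc).deriv,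
      intervalIntegral.integral_symm x b]
    ring
  have hc : ContinuousOn (fun x => ∫ t in x..b, g t) (uIcc 0 b) :=
    hG.continuousOn.neg.congr fun x _ => intervalIntegral.integral_symm b x
  rw [h2, intervalIntegral.integral_sub (hg.continuousOn_mul hF.continuousOn)
    (hf.mul_continuousOn hc)] at h
  exact sub_eq_zero.1 h

theorem ae_eq_zero_of_primitive_eq_zero {b : ℝ} {f : ℝ → ℝ} (hb : 0 ≤ b)
    (hf : IntervalIntegrable f volume 0 b) (h : ∀ x ∈ Icc 0 b, ∫ t in (0 : ℝ)..x, f t = 0) :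
    ∀ᵐ x ∂(volIoo b), f x = 0 := by
  filter_upwards [ae_restrict_mem measurableSet_Ioo,
    ae_restrict_of_ae hf.ae_hasDerivAt_integral] with x hx hd
  have hd := hd (by rw [uIcc_of_le hb]; exact Ioo_subset_Icc_self hx) 0 left_mem_uIcc
  refine hd.unique ((hasDerivAt_const x (0 : ℝ)).congr_of_eventuallyEq ?_)
  filter_upwards [Icc_mem_nhds hx.1 hx.2] with y hy using h y hy

theorem integral_congr_volIoo {b : ℝ} {f g : ℝ → ℝ} (hb : 0 ≤ b)
    (h : ∀ᵐ x ∂(volIoo b), f x = g x) : ∫ x in (0 : ℝ)..b, f x = ∫ x in (0 : ℝ)..b, g x := by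
  rw [intervalIntegral.integral_of_le hb, intervalIntegral.integral_of_le hb,
    integral_Ioc_eq_integral_Ioo, integral_Ioc_eq_integral_Ioo]
  exact integral_congr_ae h

theorem coeFn_hardy {p q b : ℝ} [Fact (1 ≤ ENNReal.ofReal p)]
    [Fact (1 ≤ ENNReal.ofReal q)] (f : LpIoo p b) : hardy p q b f =ᵐ[volIoo b] hardyFun f :=
  (memLp_hardyFun q f).coeFn_toLp

theorem coeFn_hardyDual {p q b : ℝ} [Fact (1 ≤ ENNReal.ofReal p)]
    [Fact (1 ≤ ENNReal.ofReal q)] (f : LpIoo p b) :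
    hardyDual p q b f =ᵐ[volIoo b] hardyDualFun b f :=
  (memLp_hardyDualFun q f).coeFn_toLp

theorem intervalIntegrable_lp {p b : ℝ} [Fact (1 ≤ ENNReal.ofReal p)] (hb : 0 ≤ b)
    (f : LpIoo p b) : IntervalIntegrable f volume 0 b :=
  intervalIntegrable_of_lp f le_rfl hb le_rfl

theorem integral_hardy_mul {p q b : ℝ} [Fact (1 ≤ ENNReal.ofReal p)]
    [Fact (1 ≤ ENNReal.ofReal q)] (hb : 0 ≤ b) (f : LpIoo p b) (g : LpIoo 2 b) :
    ∫ x in (0 : ℝ)..b, hardy p 2 b f x * g x =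
      ∫ x in (0 : ℝ)..b, f x * hardyDual 2 q b g x := by
  rw [integral_congr_volIoo hb (g := fun x => hardyFun f x * g x), integral_congr_volIoo hb
    (f := fun x => f x * hardyDual 2 q b g x) (g := fun x => f x * hardyDualFun b g x)]
  · exact integral_primitive_mul (intervalIntegrable_lp hb f) (intervalIntegrable_lp hb g)
  · filter_upwards [coeFn_hardyDual (q := q) g] with x hx using by rw [hx]
  · filter_upwards [coeFn_hardy (q := 2) f] with x hx using by rw [hx]

theorem norm_rpow_lp {r b : ℝ} (hb : 0 ≤ b) (hr : 0 < r) (f : LpIoo r b) :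
    ‖f‖ ^ r = ∫ x in (0 : ℝ)..b, |f x| ^ r := by
  rw [Lp.norm_def, (Lp.memLp f).eLpNorm_eq_integral_rpow_norm (by simpa using hr)
    ENNReal.ofReal_ne_top, ENNReal.toReal_ofReal hr.le,
    ENNReal.toReal_ofReal (by positivity), ← Real.rpow_mul (by positivity),
    inv_mul_cancel₀ hr.ne', Real.rpow_one, intervalIntegral.integral_of_le hb,
    integral_Ioc_eq_integral_Ioo]
  rfl

theorem integral_mul_le_norm_mul_norm {p q b : ℝ} [Fact (1 ≤ ENNReal.ofReal p)]
    [Fact (1 ≤ ENNReal.ofReal q)] (hpq : p.HolderConjugate q) (hb : 0 ≤ b) (f : LpIoo p b) (g : LpIoo q b) :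
    ∫ x in (0 : ℝ)..b, f x * g x ≤ ‖f‖ * ‖g‖ := by
  have h := integral_mul_norm_le_Lp_mul_Lq hpq (Lp.memLp f) (Lp.memLp g)
  have hn : ∀ {r : ℝ} [Fact (1 ≤ ENNReal.ofReal r)] (_ : 0 < r) (f : LpIoo r b),
      (∫ x, ‖f x‖ ^ r ∂(volIoo b)) ^ (1 / r) = ‖f‖ := by
    intro r _ hr f
    have := norm_rpow_lp hb hr f
    rw [intervalIntegral.integral_of_le hb, integral_Ioc_eq_integral_Ioo] at this
    simp only [Real.norm_eq_abs]
    rw [← this, ← Real.rpow_mul (norm_nonneg _), mul_one_div_cancel hr.ne', Real.rpow_one]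
  rw [hn hpq.pos, hn hpq.symm.pos] at h
  refine le_trans ?_ h
  rw [intervalIntegral.integral_of_le hb, integral_Ioc_eq_integral_Ioo]
  have h2 := norm_integral_le_integral_norm (μ := volIoo b) fun x => f x * g x
  simp only [norm_mul] at h2
  exact (Real.le_norm_self _).trans h2

/-! ### The map K as a double integral. -/

/-- The continuous representative of `H^* H f`, reflected about the midpoint of `[0, b]`. -/
def reflectedK (b : ℝ) (f : ℝ → ℝ) (x : ℝ) : ℝ :=
  ∫ s in (b - x)..b, hardyFun f s

theorem continuousOn_hardyFun {p b : ℝ} [Fact (1 ≤ ENNReal.ofReal p)] (hb : 0 ≤ b) (f : LpIoo p b) :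
    ContinuousOn (hardyFun f) (Icc 0 b) := by
  have := ((intervalIntegrable_lp hb f).absolutelyContinuousOnInterval_intervalIntegral (c := 0)
    left_mem_uIcc).continuousOn
  rwa [uIcc_of_le hb] at this

theorem sub_mem_Icc {b : ℝ} {x : ℝ} (hx : x ∈ Icc 0 b) : b - x ∈ Icc 0 b :=
  ⟨by linarith [hx.2], by linarith [hx.1]⟩

theorem continuousOn_comp_sub {b : ℝ} {f : ℝ → ℝ} (hf : ContinuousOn f (Icc 0 b)) :
    ContinuousOn (fun x => f (b - x)) (Icc 0 b) :=
  hf.comp (by fun_prop) fun _ hx => sub_mem_Icc hx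

theorem coeFn_hilbertianK {p q b : ℝ} [Fact (1 ≤ ENNReal.ofReal p)]
    [Fact (1 ≤ ENNReal.ofReal q)] (f : LpIoo p b) :
    ∀ᵐ x ∂(volIoo b), hilbertianK p q b f x = reflectedK b f (b - x) := by
  filter_upwards [coeFn_hardyDual (q := q) (hardy p 2 b f), ae_restrict_mem measurableSet_Ioo]
    with x hx hxb
  refine hx.trans ?_
  rw [reflectedK, sub_sub_cancel, hardyDualFun, intervalIntegral.integral_of_le hxb.2.le,
    intervalIntegral.integral_of_le hxb.2.le, integral_Ioc_eq_integral_Ioo,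
    integral_Ioc_eq_integral_Ioo]
  exact integral_congr_ae (ae_restrict_of_ae_restrict_of_subset (Ioo_subset_Ioo_left hxb.1.le)
    (coeFn_hardy f))

theorem reflectedK_zero {b : ℝ} (f : ℝ → ℝ) : reflectedK b f 0 = 0 := by simp [reflectedK]

theorem hasDerivWithinAt_reflectedK {p b : ℝ} [Fact (1 ≤ ENNReal.ofReal p)] (hb : 0 < b)
    (f : LpIoo p b) {x : ℝ} (hx : x ∈ Icc 0 b) :
    HasDerivWithinAt (reflectedK b f) (hardyFun f (b - x)) (Icc 0 b) x := by
  have hc := continuousOn_comp_sub (continuousOn_hardyFun hb.le f)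
  have hrep : ∀ y, reflectedK b f y = ∫ s in (0 : ℝ)..y, hardyFun f (b - s) := fun y => by
    rw [intervalIntegral.integral_comp_sub_left (hardyFun f) b, sub_zero, reflectedK]
  have : Fact (x ∈ Icc 0 b) := ⟨hx⟩
  have hd : HasDerivWithinAt (fun y => ∫ s in (0 : ℝ)..y, hardyFun f (b - s)) (hardyFun f (b - x))
      (Icc 0 b) x :=
    intervalIntegral.integral_hasDerivWithinAt_right
      (hc.mono (uIcc_subset_Icc (left_mem_Icc.2 hb.le) hx)).intervalIntegrable
      (hc.stronglyMeasurableAtFilter_nhdsWithin measurableSet_Icc x) (hc x hx)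
  exact hd.congr (fun y _ => hrep y) (hrep x)

theorem continuousOn_reflectedK {p b : ℝ} [Fact (1 ≤ ENNReal.ofReal p)] (hb : 0 < b)
    (f : LpIoo p b) :
    ContinuousOn (reflectedK b f) (Icc 0 b) :=
  fun _ hx => (hasDerivWithinAt_reflectedK hb f hx).continuousWithinAt

theorem norm_hilbertianK_rpow {p q b : ℝ} [Fact (1 ≤ ENNReal.ofReal p)]
    [Fact (1 ≤ ENNReal.ofReal q)] (hb : 0 ≤ b) (hq : 0 < q) (f : LpIoo p b) :
    ‖hilbertianK p q b f‖ ^ q = ∫ x in (0 : ℝ)..b, |reflectedK b f x| ^ q := by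
  rw [norm_rpow_lp hb hq, integral_congr_volIoo hb (g := fun x => |reflectedK b f (b - x)| ^ q)]
  · simp [intervalIntegral.integral_comp_sub_left (fun x => |reflectedK b f x| ^ q) b]
  · filter_upwards [coeFn_hilbertianK (q := q) f] with x hx using by rw [hx]

theorem integral_hardyFun_sq_eq {p q b : ℝ} [Fact (1 ≤ ENNReal.ofReal p)]
    [Fact (1 ≤ ENNReal.ofReal q)] (hb : 0 ≤ b) (f : LpIoo p b) :
    ∫ x in (0 : ℝ)..b, hardyFun f x ^ 2 = ∫ x in (0 : ℝ)..b, f x * hilbertianK p q b f x := by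
  have h := integral_hardy_mul (q := q) hb f (hardy p 2 b f)
  refine Eq.trans ?_ h
  refine integral_congr_volIoo hb ?_
  filter_upwards [coeFn_hardy (q := 2) f] with x hx using by rw [hx, sq]

/-- If Kf = 0, then ∫ (Hf)² = ∫ f Kf = 0, so Hf vanishes and f = 0 by Lebesgue differentiation. -/
theorem hilbertianK_injective {p q b : ℝ} [Fact (1 ≤ ENNReal.ofReal p)]
    [Fact (1 ≤ ENNReal.ofReal q)] (hb : 0 < b) : Function.Injective (hilbertianK p q b) := by
  refine (injective_iff_map_eq_zero _).2 fun f hf => ?_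
  have h := integral_hardyFun_sq_eq (q := q) hb.le f
  rw [integral_congr_volIoo hb.le (f := fun x => f x * hilbertianK p q b f x) (g := fun _ => 0),
    intervalIntegral.integral_zero] at h
  · rw [Lp.eq_zero_iff_ae_eq_zero]
    refine ae_eq_zero_of_primitive_eq_zero hb.le (intervalIntegrable_lp hb.le f) fun x hx => ?_
    exact pow_eq_zero_iff two_ne_zero |>.1 (eqOn_zero_of_integral_eq_zero hb
      ((continuousOn_hardyFun hb.le f).pow 2) (fun x _ => sq_nonneg _) h hx)
  · filter_upwards [Lp.coeFn_zero ℝ (ENNReal.ofReal q) (volIoo b)] with x hx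
    rw [hf, hx]; simp

theorem hilbertianK_eq_of_reflectedK_eq {p q b : ℝ} [Fact (1 ≤ ENNReal.ofReal p)]
    [Fact (1 ≤ ENNReal.ofReal q)] {f g : LpIoo p b}
    (h : ∀ x ∈ Icc 0 b, reflectedK b f x = reflectedK b g x) :
    hilbertianK p q b f = hilbertianK p q b g := by
  refine Lp.ext ?_
  filter_upwards [coeFn_hilbertianK (q := q) f, coeFn_hilbertianK (q := q) g,
    ae_restrict_mem measurableSet_Ioo] with x h1 h2 hx
  rw [h1, h2, h _ (sub_mem_Icc (Ioo_subset_Icc_self hx))]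

/-- Integrating -u''(b - ·) from 0 gives u'(b - ·) since u'(b) = 0, and a second integration gives u
since u(0) = 0. -/
theorem reflectedK_eq {p b : ℝ} {u u' u'' : ℝ → ℝ} (hb : 0 < b)
    (hu : ∀ x ∈ Icc 0 b, HasDerivWithinAt u (u' x) (Icc 0 b) x)
    (hu' : ∀ x ∈ Icc 0 b, HasDerivWithinAt u' (u'' x) (Icc 0 b) x)
    (hu'' : ContinuousOn u'' (Icc 0 b)) (h0 : u 0 = 0) (h1 : u' b = 0) {f : LpIoo p b}
    (hf : ∀ᵐ x ∂(volIoo b), f x = -u'' (b - x)) {x : ℝ} (hx : x ∈ Icc 0 b) :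
    reflectedK b f x = u x := by
  have ftc : ∀ v v' : ℝ → ℝ, (∀ x ∈ Icc 0 b, HasDerivWithinAt v (v' x) (Icc 0 b) x) →
      ContinuousOn v' (Icc 0 b) → ∀ y ∈ Icc 0 b, ∀ z ∈ Icc 0 b, y ≤ z →
      ∫ t in y..z, v' t = v z - v y := fun v v' hv hv' y hy z hz hyz =>
    intervalIntegral.integral_eq_sub_of_hasDerivAt_of_le hyz
      (fun t ht => ((hv t ⟨hy.1.trans ht.1, ht.2.trans hz.2⟩).mono
        (Icc_subset_Icc hy.1 hz.2)).continuousWithinAt)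
      (fun t ht => (hv t ⟨hy.1.trans ht.1.le, ht.2.le.trans hz.2⟩).hasDerivAt
        (Icc_mem_nhds (hy.1.trans_lt ht.1) (ht.2.trans_le hz.2)))
      (hv'.mono (uIcc_subset_Icc hy hz)).intervalIntegrable
  have hH : ∀ y ∈ Icc 0 b, hardyFun f y = u' (b - y) := fun y hy => by
    rw [hardyFun, intervalIntegral.integral_of_le hy.1, integral_Ioc_eq_integral_Ioo,
      integral_congr_ae (ae_restrict_of_ae_restrict_of_subset (Ioo_subset_Ioo_right hy.2) hf),
      ← integral_Ioc_eq_integral_Ioo, ← intervalIntegral.integral_of_le hy.1,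
      intervalIntegral.integral_comp_sub_left (fun t => -u'' t) b, intervalIntegral.integral_neg,
      sub_zero, ftc u' u'' hu' hu'' _ (sub_mem_Icc hy) _ (right_mem_Icc.2 hb.le)
        (sub_mem_Icc hy).2, h1]
    ring
  have hu'c : ContinuousOn u' (Icc 0 b) := fun x hx => (hu' x hx).continuousWithinAt
  have hI : reflectedK b f x = ∫ s in (b - x)..b, u' (b - s) := by
    refine intervalIntegral.integral_congr fun s hs => ?_
    rw [uIcc_of_le (sub_mem_Icc hx).2] at hs
    exact hH s ⟨(sub_mem_Icc hx).1.trans hs.1, hs.2⟩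
  rw [hI, intervalIntegral.integral_comp_sub_left u' b, sub_self, sub_sub_cancel,
    ftc u u' hu hu'c _ (left_mem_Icc.2 hb.le) _ hx hx.1, h0, sub_zero]

/-! ### The norm and the extremals of K. -/

/-- Sobolev and Hölder give ‖Kf‖² ≤ C ∫ (Hf)² ≤ C ‖f‖ ‖Kf‖. Equality at the ends forces equality in
the Sobolev step, and its equality case applies. -/
theorem norm_hilbertianK_le {p q b : ℝ} [Fact (1 ≤ ENNReal.ofReal p)]
    [Fact (1 ≤ ENNReal.ofReal q)] (hpq : p.HolderConjugate q) (hb : 0 < b) (f : LpIoo p b) :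
    ‖hilbertianK p q b f‖ ≤ sharpConst q b * ‖f‖ ∧
    (f ≠ 0 → ‖hilbertianK p q b f‖ = sharpConst q b * ‖f‖ →
      ∃ c : ℝ, c ≠ 0 ∧ ∀ x ∈ Icc 0 b, reflectedK b f x = c * quarterSin q b x) := by
  have hq := hpq.symm.lt
  have hC := sharpConst_pos hq hb
  rcases eq_or_ne (hilbertianK p q b f) 0 with h0 | h0
  · rw [h0, norm_zero]
    refine ⟨by positivity, fun hf =>
      absurd (hilbertianK_injective hb (h0.trans (map_zero _).symm)) hf⟩
  have hpos : 0 < ‖hilbertianK p q b f‖ := norm_pos_iff.2 h0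
  set κ := ‖hilbertianK p q b f‖ with hκ
  have hpow := norm_hilbertianK_rpow hb.le (by linarith : 0 < q) f
  rw [← hκ] at hpow
  obtain ⟨h1, h2⟩ := sobolev_quarter (w := reflectedK b f) (w' := fun x => hardyFun f (b - x)) hq hb
    (fun x hx => hasDerivWithinAt_reflectedK hb f hx)
    (continuousOn_comp_sub (continuousOn_hardyFun hb.le f)) (reflectedK_zero _)
    (by rw [← hpow]; positivity)
  have hκ2 : (κ ^ q) ^ (2 / q) = κ ^ 2 := by
    rw [← Real.rpow_mul hpos.le, mul_div_cancel₀ _ (by linarith), Real.rpow_two]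
  have hE : ∫ x in (0 : ℝ)..b, hardyFun f (b - x) ^ 2 ≤ ‖f‖ * κ := by
    rw [intervalIntegral.integral_comp_sub_left (fun x => hardyFun f x ^ 2) b, sub_self, sub_zero,
      integral_hardyFun_sq_eq (q := q) hb.le]
    exact integral_mul_le_norm_mul_norm hpq hb.le _ _
  rw [← hpow, hκ2] at h1 h2
  have hE' := mul_le_mul_of_nonneg_left hE hC.le
  refine ⟨?_, fun _ heq => h2 (le_antisymm h1 ?_)⟩
  · have : κ * κ ≤ sharpConst q b * ‖f‖ * κ := by nlinarith
    exact le_of_mul_le_mul_right this hpos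
  · refine hE'.trans_eq ?_
    rw [← mul_assoc, ← heq, sq]

theorem exists_lp_of_continuousOn {p b : ℝ} {v : ℝ → ℝ} (hv : ContinuousOn v (Icc 0 b)) :
    ∃ f : LpIoo p b, ∀ᵐ x ∂(volIoo b), f x = v x := by
  obtain ⟨C, hC⟩ := isCompact_Icc.exists_bound_of_continuousOn hv
  have hm : MemLp v (ENNReal.ofReal p) (volIoo b) := by
    refine MemLp.of_bound ((hv.mono Ioo_subset_Icc_self).aestronglyMeasurable measurableSet_Ioo)
      C ?_
    filter_upwards [ae_restrict_mem measurableSet_Ioo] with x hx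
      using hC x (Ioo_subset_Icc_self hx)
  exact ⟨hm.toLp v, hm.coeFn_toLp⟩

theorem norm_rpow_of_ae_eq {p b : ℝ} {f : LpIoo p b} {v : ℝ → ℝ} (hb : 0 ≤ b) (hp : 0 < p)
    (h : ∀ᵐ x ∂(volIoo b), f x = v (b - x)) : ‖f‖ ^ p = ∫ x in (0 : ℝ)..b, |v x| ^ p := by
  rw [norm_rpow_lp hb hp, integral_congr_volIoo hb (g := fun x => |v (b - x)| ^ p)]
  · simp [intervalIntegral.integral_comp_sub_left (fun x => |v x| ^ p) b]
  · filter_upwards [h] with x hx using by rw [hx]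

theorem continuousOn_reflected_quarterSin {q b c : ℝ} (hq : 1 < q) (hb : 0 < b) :
    ContinuousOn (fun x => c * quarterSin q b (b - x) ^ (q - 1)) (Icc 0 b) :=
  continuousOn_const.mul
    (continuousOn_comp_sub (continuousOn_quarterSin_rpow (r := q - 1) hq hb (by linarith)))

theorem coeff_pos {q b : ℝ} (hq : 1 < q) (hb : 0 < b) : 0 < q / 2 * sinFreq q b ^ 2 := by
  have := sinFreq_pos hq hb
  positivity

theorem reflectedK_of_ae_eq {p q b c : ℝ} (hq : 1 < q) (hb : 0 < b) {f : LpIoo p b}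
    (hf : ∀ᵐ x ∂(volIoo b), f x = c * quarterSin q b (b - x) ^ (q - 1)) {x : ℝ}
    (hx : x ∈ Icc 0 b) :
    reflectedK b f x = c / (q / 2 * sinFreq q b ^ 2) * quarterSin q b x := by
  have ha := coeff_pos hq hb
  refine reflectedK_eq (u := fun x => c / (q / 2 * sinFreq q b ^ 2) * quarterSin q b x)
    (u' := fun x => c / (q / 2 * sinFreq q b ^ 2) * quarterCos q b x)
    (u'' := fun x => c / (q / 2 * sinFreq q b ^ 2) *
      (-(q / 2 * sinFreq q b ^ 2) * quarterSin q b x ^ (q - 1))) hb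
    (fun x hx => (hasDerivWithinAt_quarterSin hq hb hx).const_mul _)
    (fun x hx => (hasDerivWithinAt_quarterCos hq hb hx).const_mul _)
    (continuousOn_const.mul (continuousOn_const.mul
      (continuousOn_quarterSin_rpow hq hb (by linarith))))
    (by simp [quarterSin_zero hq hb]) (by simp [quarterCos_right hq hb]) ?_ hx
  filter_upwards [hf] with x hx
  have hk := sinFreq_pos hq hb
  rw [hx]
  field_simp

theorem integral_abs_mul_quarterSin_rpow {p q b c : ℝ} (hpq : p.HolderConjugate q) (hb : 0 < b) :
    ∫ x in (0 : ℝ)..b, |c * quarterSin q b x ^ (q - 1)| ^ p = |c| ^ p * (2 * b / (q + 2)) := by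
  rw [← integral_quarterSin_rpow hpq.symm.lt hb, ← intervalIntegral.integral_const_mul]
  refine intervalIntegral.integral_congr fun x hx => ?_
  rw [uIcc_of_le hb.le] at hx
  have h0 := (quarterSin_spec hpq.symm.lt hb hx).1.1
  rw [abs_mul, Real.mul_rpow (abs_nonneg _) (abs_nonneg _), abs_of_nonneg (Real.rpow_nonneg h0 _),
    ← Real.rpow_mul h0, mul_comm (q - 1), mul_sub, mul_one, hpq.mul_eq_add, add_sub_cancel_left]

theorem norm_of_ae_eq {p q b c : ℝ} [Fact (1 ≤ ENNReal.ofReal p)] (hpq : p.HolderConjugate q)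
    (hb : 0 < b) {f : LpIoo p b}
    (hf : ∀ᵐ x ∂(volIoo b), f x = c * quarterSin q b (b - x) ^ (q - 1)) :
    ‖f‖ = |c| * (2 * b / (q + 2)) ^ (1 / p) := by
  have hp := hpq.pos
  have hq := hpq.symm.pos
  have h := norm_rpow_of_ae_eq (v := fun x => c * quarterSin q b x ^ (q - 1)) hb.le hp hf
  rw [integral_abs_mul_quarterSin_rpow hpq hb] at h
  refine (Real.rpow_left_inj (norm_nonneg _) (by positivity) hp.ne').1 ?_
  rw [h, Real.mul_rpow (abs_nonneg _) (by positivity), ← Real.rpow_mul (by positivity),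
    one_div_mul_cancel hp.ne', Real.rpow_one]

theorem norm_hilbertianK_of_ae_eq {p q b c : ℝ} [Fact (1 ≤ ENNReal.ofReal p)]
    [Fact (1 ≤ ENNReal.ofReal q)] (hpq : p.HolderConjugate q) (hb : 0 < b) {f : LpIoo p b}
    (hf : ∀ᵐ x ∂(volIoo b), f x = c * quarterSin q b (b - x) ^ (q - 1)) :
    ‖hilbertianK p q b f‖ = sharpConst q b * ‖f‖ := by
  have hq := hpq.symm.pos
  have ha := coeff_pos hpq.symm.lt hb
  have hn : 0 < 2 * b / (q + 2) := by positivity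
  have h := norm_hilbertianK_rpow hb.le hq f
  have h2 : ∫ x in (0 : ℝ)..b, |reflectedK b f x| ^ q =
      (|c| / (q / 2 * sinFreq q b ^ 2)) ^ q * (2 * b / (q + 2)) := by
    rw [← integral_quarterSin_rpow hpq.symm.lt hb, ← intervalIntegral.integral_const_mul]
    refine intervalIntegral.integral_congr fun x hx => ?_
    rw [uIcc_of_le hb.le] at hx
    have h0 := (quarterSin_spec hpq.symm.lt hb hx).1.1
    simp only [reflectedK_of_ae_eq hpq.symm.lt hb hf hx]
    rw [abs_mul, abs_div, abs_of_pos ha, abs_of_nonneg h0, Real.mul_rpow (by positivity) h0]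
  have h3 : ‖hilbertianK p q b f‖ =
      |c| / (q / 2 * sinFreq q b ^ 2) * (2 * b / (q + 2)) ^ (1 / q) := by
    refine (Real.rpow_left_inj (norm_nonneg _) (by positivity) hq.ne').1 ?_
    rw [h, h2, Real.mul_rpow (by positivity) (by positivity), ← Real.rpow_mul hn.le,
      one_div_mul_cancel hq.ne', Real.rpow_one]
  -- By conjugacy of p and q; it splits the exponent 1/q into the one in `sharpConst` and the one in
  -- ‖f‖.
  have h4 : (1 : ℝ) / q = (2 / q - 1) + 1 / p := by
    have := hpq.inv_add_inv_eq_one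
    rw [one_div, one_div, div_eq_mul_inv]
    linarith
  have hk := sinFreq_pos hpq.symm.lt hb
  rw [h3, norm_of_ae_eq hpq hb hf, h4, Real.rpow_add hn, sharpConst]
  field_simp

theorem norm_hilbertianK {p q b : ℝ} [Fact (1 ≤ ENNReal.ofReal p)]
    [Fact (1 ≤ ENNReal.ofReal q)] (hpq : p.HolderConjugate q) (hb : 0 < b) :
    ‖hilbertianK p q b‖ = sharpConst q b := by
  have hC := sharpConst_pos hpq.symm.lt hb
  refine le_antisymm (ContinuousLinearMap.opNorm_le_bound _ hC.le
    fun f => (norm_hilbertianK_le hpq hb f).1) ?_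
  obtain ⟨f, hf⟩ := exists_lp_of_continuousOn (p := p)
    (continuousOn_reflected_quarterSin (c := 1) hpq.symm.lt hb)
  have hn : 0 < ‖f‖ := by
    have := hpq.symm.pos
    rw [norm_of_ae_eq hpq hb hf]; positivity
  have := (hilbertianK p q b).le_opNorm f
  rw [norm_hilbertianK_of_ae_eq hpq hb hf] at this
  exact le_of_mul_le_mul_right this hn

theorem isExtremal_of_ae_eq {p q b c : ℝ} [Fact (1 ≤ ENNReal.ofReal p)]
    [Fact (1 ≤ ENNReal.ofReal q)] (hpq : p.HolderConjugate q) (hb : 0 < b) (hc : c ≠ 0)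
    {f : LpIoo p b} (hf : ∀ᵐ x ∂(volIoo b), f x = c * quarterSin q b (b - x) ^ (q - 1)) :
    IsExtremal (hilbertianK p q b) f := by
  have hq := hpq.symm.pos
  refine ⟨norm_ne_zero_iff.1 ?_, ?_⟩
  · rw [norm_of_ae_eq hpq hb hf]; positivity
  · rw [norm_hilbertianK hpq hb, norm_hilbertianK_of_ae_eq hpq hb hf]

/-- The explicit power of the sine has the same image under K, and K is injective; no
differentiation of Kf is needed. -/
theorem ae_eq_of_reflectedK_eq {p q b c : ℝ} [Fact (1 ≤ ENNReal.ofReal p)]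
    [Fact (1 ≤ ENNReal.ofReal q)] (hpq : p.HolderConjugate q) (hb : 0 < b) {f : LpIoo p b}
    (hf : ∀ x ∈ Icc 0 b, reflectedK b f x = c * quarterSin q b x) :
    ∀ᵐ x ∂(volIoo b), f x =
      c * (q / 2 * sinFreq q b ^ 2) * quarterSin q b (b - x) ^ (q - 1) := by
  have ha := coeff_pos hpq.symm.lt hb
  obtain ⟨g, hg⟩ := exists_lp_of_continuousOn (p := p)
    (continuousOn_reflected_quarterSin (c := c * (q / 2 * sinFreq q b ^ 2)) hpq.symm.lt hb)
  have : f = g := hilbertianK_injective (q := q) hb <|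
      hilbertianK_eq_of_reflectedK_eq fun x hx => by
    rw [hf x hx, reflectedK_of_ae_eq hpq.symm.lt hb hg hx, mul_div_cancel_right₀ _ ha.ne']
  rwa [this]

theorem isExtremal_iff_reflectedK {p q b : ℝ} [Fact (1 ≤ ENNReal.ofReal p)]
    [Fact (1 ≤ ENNReal.ofReal q)] (hpq : p.HolderConjugate q) (hb : 0 < b) {f : LpIoo p b} :
    IsExtremal (hilbertianK p q b) f ↔
      ∃ c : ℝ, c ≠ 0 ∧ ∀ x ∈ Icc 0 b, reflectedK b f x = c * quarterSin q b x := by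
  constructor
  · rintro ⟨hf, he⟩
    rw [norm_hilbertianK hpq hb] at he
    exact (norm_hilbertianK_le hpq hb f).2 hf he
  · rintro ⟨c, hc, h⟩
    exact isExtremal_of_ae_eq hpq hb (mul_ne_zero hc (coeff_pos hpq.symm.lt hb).ne')
      (ae_eq_of_reflectedK_eq hpq hb h)

theorem isExtremal_iff_ae_eq {p q b : ℝ} [Fact (1 ≤ ENNReal.ofReal p)]
    [Fact (1 ≤ ENNReal.ofReal q)] (hpq : p.HolderConjugate q) (hb : 0 < b) {f : LpIoo p b} :
    IsExtremal (hilbertianK p q b) f ↔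
      ∃ c : ℝ, c ≠ 0 ∧ ∀ᵐ x ∂(volIoo b), f x = c * quarterSin q b (b - x) ^ (q - 1) := by
  constructor
  · intro h
    obtain ⟨c, hc, h⟩ := (isExtremal_iff_reflectedK hpq hb).1 h
    exact ⟨_, mul_ne_zero hc (coeff_pos hpq.symm.lt hb).ne', ae_eq_of_reflectedK_eq hpq hb h⟩
  · rintro ⟨c, hc, h⟩
    exact isExtremal_of_ae_eq hpq hb hc h

/-! ### Signed powers. -/

theorem signedPow_mul (p x y : ℝ) : signedPow p (x * y) = signedPow p x * signedPow p y := by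
  rw [signedPow, abs_mul, Real.mul_rpow (abs_nonneg _) (abs_nonneg _), signedPow, signedPow]
  ring

theorem signedPow_of_nonneg {p x : ℝ} (hp : 1 < p) (hx : 0 ≤ x) : signedPow p x = x ^ (p - 1) := by
  rw [signedPow, abs_of_nonneg hx]
  rcases hx.eq_or_lt with rfl | h
  · rw [mul_zero, Real.zero_rpow (by linarith)]
  · rw [← Real.rpow_add_one h.ne']; ring_nf

theorem signedPow_neg (p x : ℝ) : signedPow p (-x) = -signedPow p x := by
  rw [signedPow, abs_neg, signedPow, mul_neg]

theorem signedPow_mul_self {p : ℝ} (hp : 0 < p) (x : ℝ) : signedPow p x * x = |x| ^ p := by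
  rcases eq_or_ne x 0 with rfl | h
  · rw [mul_zero, abs_zero, Real.zero_rpow hp.ne']
  · rw [signedPow, mul_assoc, ← abs_mul_abs_self, ← sq, ← Real.rpow_two,
      ← Real.rpow_add (abs_pos.2 h), sub_add_cancel]

theorem signedPow_signedPow {p q : ℝ} (hpq : p.HolderConjugate q) (x : ℝ) :
    signedPow p (signedPow q x) = x := by
  have key : ∀ y : ℝ, 0 ≤ y → signedPow p (signedPow q y) = y := fun y hy => by
    rw [signedPow_of_nonneg hpq.symm.lt hy, signedPow_of_nonneg hpq.lt (Real.rpow_nonneg hy _),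
      ← Real.rpow_mul hy]
    have : (q - 1) * (p - 1) = 1 := by linarith [hpq.mul_eq_add]
    rw [this, Real.rpow_one]
  rcases le_total 0 x with h | h
  · exact key x h
  · have := key (-x) (by linarith)
    rw [signedPow_neg, signedPow_neg] at this
    linarith

/-- The factor |x|^(p-2) is singular at 0 when p < 2; splitting into positive and negative parts
leaves only the positive exponent p - 1. -/
theorem continuous_signedPow {p : ℝ} (hp : 1 < p) : Continuous (signedPow p) := by
  have h : signedPow p = fun x => (max x 0) ^ (p - 1) - (max (-x) 0) ^ (p - 1) := by
    ext x
    have hz : (0 : ℝ) ^ (p - 1) = 0 := Real.zero_rpow (by linarith)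
    rcases le_total 0 x with h | h
    · rw [signedPow_of_nonneg hp h, max_eq_left h, max_eq_right (by linarith), hz, sub_zero]
    · have := signedPow_of_nonneg hp (neg_nonneg.2 h)
      rw [signedPow_neg] at this
      rw [max_eq_right h, max_eq_left (by linarith), hz, ← this]; ring
  rw [h]
  exact ((continuous_id.max continuous_const).rpow_const fun _ => Or.inr (by linarith)).sub
    ((continuous_neg.max continuous_const).rpow_const fun _ => Or.inr (by linarith))

/-! ### The bi-Laplacian eigenvalue problem. -/

theorem derivIcc_of_eqOn {b : ℝ} {f g g' : ℝ → ℝ} (hb : 0 < b) (hfg : ∀ x ∈ Icc 0 b, f x = g x)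
    (hg : ∀ x ∈ Icc 0 b, HasDerivWithinAt g (g' x) (Icc 0 b) x) :
    DifferentiableOn ℝ f (Icc 0 b) ∧ ∀ x ∈ Icc 0 b, derivIcc b f x = g' x := by
  have hf : ∀ x ∈ Icc 0 b, HasDerivWithinAt f (g' x) (Icc 0 b) x := fun x hx =>
    (hg x hx).congr hfg (hfg x hx)
  exact ⟨fun x hx => (hf x hx).differentiableWithinAt,
    fun x hx => (hf x hx).derivWithin (uniqueDiffOn_Icc hb x hx)⟩

/-- Two derivatives turn S into a multiple of S^(q-1), and the signed power with exponent p - 1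
turns this back into a multiple of S. Two more derivatives close the circle. -/
theorem isEigenpair_of_eqOn {p q b c : ℝ} {u : ℝ → ℝ} (hpq : p.HolderConjugate q) (hb : 0 < b)
    (hc : c ≠ 0) (hu : ∀ x ∈ Icc 0 b, u x = c * quarterSin q b x) :
    IsEigenpair p q b (|c| ^ (p - q) * (q / 2 * sinFreq q b ^ 2) ^ p) u ∧
    ∀ x ∈ Icc 0 b, derivIcc b (derivIcc b u) x =
      -c * (q / 2 * sinFreq q b ^ 2) * quarterSin q b x ^ (q - 1) := by
  have hq := hpq.symm.lt
  have ha := coeff_pos hq hb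
  set a := q / 2 * sinFreq q b ^ 2 with hadef
  obtain ⟨d0, e1⟩ := derivIcc_of_eqOn hb hu fun x hx =>
    (hasDerivWithinAt_quarterSin hq hb hx).const_mul c
  obtain ⟨d1, e2⟩ := derivIcc_of_eqOn hb e1 fun x hx =>
    (hasDerivWithinAt_quarterCos hq hb hx).const_mul c
  have e2' : ∀ x ∈ Icc 0 b, derivIcc b (derivIcc b u) x = -c * a * quarterSin q b x ^ (q - 1) :=
    fun x hx => (e2 x hx).trans (by ring)
  have e3 : ∀ x ∈ Icc 0 b, signedPow p (derivIcc b (derivIcc b u) x) =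
      signedPow p (-c * a) * quarterSin q b x := fun x hx => by
    rw [e2' x hx, signedPow_mul, ← signedPow_of_nonneg hq (quarterSin_spec hq hb hx).1.1,
      signedPow_signedPow hpq]
  obtain ⟨d2, e4⟩ := derivIcc_of_eqOn hb e3 fun x hx =>
    (hasDerivWithinAt_quarterSin hq hb hx).const_mul _
  obtain ⟨d3, e5⟩ := derivIcc_of_eqOn hb e4 fun x hx =>
    (hasDerivWithinAt_quarterCos hq hb hx).const_mul _
  have hl : (0 : ℝ) ∈ Icc 0 b := left_mem_Icc.2 hb.le
  have hr : b ∈ Icc 0 b := right_mem_Icc.2 hb.le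
  refine ⟨⟨⟨b, hr, ?_⟩, d0, d1, d2, d3, fun x hx => ?_, ?_, ?_, ?_, ?_⟩, e2'⟩
  · rw [hu b hr, quarterSin_right hq hb, mul_one]; exact hc
  · have h1 : signedPow p (-c * a) = -(signedPow p c * a ^ (p - 1)) := by
      rw [signedPow_mul, signedPow_neg, signedPow_of_nonneg hpq.lt ha.le]; ring
    have h2 : signedPow p c = |c| ^ (p - q) * signedPow q c := by
      rw [signedPow, signedPow, ← mul_assoc, ← Real.rpow_add (abs_pos.2 hc)]
      congr 2; ring
    have h3 : a ^ p = a ^ (p - 1) * a := by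
      rw [← Real.rpow_add_one ha.ne', sub_add_cancel]
    rw [e5 x hx, hu x hx, h1, signedPow_mul q c,
      signedPow_of_nonneg hq (quarterSin_spec hq hb hx).1.1, h2, h3, ← hadef]
    ring
  · rw [hu 0 hl, quarterSin_zero hq hb, mul_zero]
  · rw [e1 b hr, quarterCos_right hq hb, mul_zero]
  · rw [e3 0 hl, quarterSin_zero hq hb, mul_zero]
  · rw [e4 b hr, quarterCos_right hq hb, mul_zero]

theorem IsEigenpair.hasDerivWithinAt_zero {p q b lam : ℝ} {u : ℝ → ℝ} (h : IsEigenpair p q b lam u)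
    {x : ℝ} (hx : x ∈ Icc 0 b) : HasDerivWithinAt u (derivIcc b u x) (Icc 0 b) x :=
  (h.diff_zero x hx).hasDerivWithinAt

theorem IsEigenpair.hasDerivWithinAt_one {p q b lam : ℝ} {u : ℝ → ℝ} (h : IsEigenpair p q b lam u)
    {x : ℝ} (hx : x ∈ Icc 0 b) :
    HasDerivWithinAt (derivIcc b u) (derivIcc b (derivIcc b u) x) (Icc 0 b) x :=
  (h.diff_one x hx).hasDerivWithinAt

/-- Continuity of u'' is not part of the definition; it is recovered from that of [u'']^(p-1)
through the continuous inverse signed power. -/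
theorem IsEigenpair.continuousOn_two {p q b lam : ℝ} {u : ℝ → ℝ} (h : IsEigenpair p q b lam u)
    (hpq : p.HolderConjugate q) : ContinuousOn (derivIcc b (derivIcc b u)) (Icc 0 b) :=
  ((continuous_signedPow hpq.symm.lt).comp_continuousOn h.diff_two.continuousOn).congr
    fun _ _ => (signedPow_signedPow hpq.symm _).symm

/-- Multiply the equation by u and integrate by parts twice; each of the four boundary conditions
removes one boundary term. -/
theorem IsEigenpair.integral_eq {p q b lam : ℝ} {u : ℝ → ℝ} (h : IsEigenpair p q b lam u)
    (hpq : p.HolderConjugate q) (hb : 0 < b) :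
    ∫ x in (0 : ℝ)..b, |derivIcc b (derivIcc b u) x| ^ p =
      lam * ∫ x in (0 : ℝ)..b, |u x| ^ q := by
  have hi : ∀ {f : ℝ → ℝ}, ContinuousOn f (Icc 0 b) → IntervalIntegrable f volume 0 b :=
    fun hf => ContinuousOn.intervalIntegrable (by rwa [uIcc_of_le hb.le])
  have hI := uIcc_of_le hb.le
  set v : ℝ → ℝ := fun x => signedPow p (derivIcc b (derivIcc b u) x) with hv
  have hv4 : ContinuousOn (derivIcc b (derivIcc b v)) (Icc 0 b) :=
    (continuousOn_const.mul ((continuous_signedPow hpq.symm.lt).comp_continuousOn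
      h.diff_zero.continuousOn)).congr h.equation
  have h1 := intervalIntegral.integral_mul_deriv_eq_deriv_mul_of_hasDerivWithinAt
    (a := 0) (b := b) (u := v) (v := derivIcc b u) (u' := derivIcc b v)
    (v' := derivIcc b (derivIcc b u))
    (by rw [hI]; exact fun x hx => (h.diff_two x hx).hasDerivWithinAt)
    (by rw [hI]; exact fun x hx => h.hasDerivWithinAt_one hx)
    (hi h.diff_three.continuousOn) (hi (h.continuousOn_two hpq))
  have h2 := intervalIntegral.integral_mul_deriv_eq_deriv_mul_of_hasDerivWithinAt
    (a := 0) (b := b) (u := derivIcc b v) (v := u) (u' := derivIcc b (derivIcc b v))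
    (v' := derivIcc b u)
    (by rw [hI]; exact fun x hx => (h.diff_three x hx).hasDerivWithinAt)
    (by rw [hI]; exact fun x hx => h.hasDerivWithinAt_zero hx)
    (hi hv4) (hi h.diff_one.continuousOn)
  have hv0 : v 0 = 0 := h.bc_two
  have hvb : derivIcc b v b = 0 := h.bc_three
  rw [h.bc_one, hv0, h2, hvb, h.bc_zero] at h1
  have h3 : ∫ x in (0 : ℝ)..b, |derivIcc b (derivIcc b u) x| ^ p =
      ∫ x in (0 : ℝ)..b, v x * derivIcc b (derivIcc b u) x :=
    intervalIntegral.integral_congr fun x _ => (signedPow_mul_self hpq.pos _).symm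
  have h4 : ∫ x in (0 : ℝ)..b, derivIcc b (derivIcc b v) x * u x =
      ∫ x in (0 : ℝ)..b, lam * |u x| ^ q := by
    refine intervalIntegral.integral_congr fun x hx => ?_
    rw [hI] at hx
    simp only [hv]
    rw [h.equation x hx, mul_assoc, signedPow_mul_self hpq.symm.pos]
  rw [h3, h1, h4, intervalIntegral.integral_const_mul]
  ring

theorem IsNormalizedEigenpair.exists_lp {p q b lam : ℝ} [Fact (1 ≤ ENNReal.ofReal p)]
    [Fact (1 ≤ ENNReal.ofReal q)] {u : ℝ → ℝ} (hpq : p.HolderConjugate q) (hb : 0 < b)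
    (h : IsNormalizedEigenpair p q b lam u) :
    ∃ f : LpIoo p b, ‖f‖ = 1 ∧ (∀ x ∈ Icc 0 b, reflectedK b f x = u x) ∧
      0 < ‖hilbertianK p q b f‖ ∧ lam = ‖hilbertianK p q b f‖ ^ (-q) := by
  obtain ⟨h, hn⟩ := h
  obtain ⟨f, hf⟩ := exists_lp_of_continuousOn (p := p)
    (continuousOn_comp_sub (h.continuousOn_two hpq).neg)
  have hf1 : ‖f‖ = 1 := by
    have := norm_rpow_of_ae_eq hb.le hpq.pos hf
    simp only [Pi.neg_apply, abs_neg] at this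
    rw [hn] at this
    exact (Real.rpow_left_inj (norm_nonneg _) zero_le_one hpq.ne_zero).1
      (this.trans (Real.one_rpow p).symm)
  have hr : ∀ x ∈ Icc 0 b, reflectedK b f x = u x := fun x hx =>
    reflectedK_eq hb (fun x hx => h.hasDerivWithinAt_zero hx)
      (fun x hx => h.hasDerivWithinAt_one hx) (h.continuousOn_two hpq) h.bc_zero h.bc_one hf hx
  have hK := norm_hilbertianK_rpow hb.le hpq.symm.pos f
  rw [intervalIntegral.integral_congr (g := fun x => |u x| ^ q) fun x hx => by
    rw [uIcc_of_le hb.le] at hx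
    simp only [hr x hx]] at hK
  have hlam := h.integral_eq hpq hb
  rw [hn, ← hK] at hlam
  have hpos : 0 < ‖hilbertianK p q b f‖ := by
    refine norm_pos_iff.2 fun h0 => ?_
    rw [h0, norm_zero, Real.zero_rpow hpq.symm.ne_zero, mul_zero] at hlam
    exact one_ne_zero hlam
  refine ⟨f, hf1, hr, hpos, ?_⟩
  rw [Real.rpow_neg hpos.le]
  exact eq_inv_of_mul_eq_one_left hlam.symm

theorem exists_normalized_quarterSin {p q b : ℝ} (hpq : p.HolderConjugate q) (hb : 0 < b) :
    ∃ d : ℝ, d ≠ 0 ∧ ∀ u : ℝ → ℝ, (∀ x ∈ Icc 0 b, u x = d * quarterSin q b x) →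
      ∃ lam, IsNormalizedEigenpair p q b lam u := by
  have ha := coeff_pos hpq.symm.lt hb
  have hq := hpq.symm.pos
  have hn : 0 < 2 * b / (q + 2) := by positivity
  -- For u = d S and a = (q/2) k², ∫ |u''|^p = (|d| a)^p · 2b/(q+2); this d makes it 1.
  refine ⟨(q / 2 * sinFreq q b ^ 2)⁻¹ * (2 * b / (q + 2)) ^ (-1 / p), by positivity,
    fun u hu => ?_⟩
  obtain ⟨h1, h2⟩ := isEigenpair_of_eqOn hpq hb (by positivity) hu
  refine ⟨_, h1, ?_⟩
  rw [intervalIntegral.integral_congr (g := fun x => |-((q / 2 * sinFreq q b ^ 2)⁻¹ *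
    (2 * b / (q + 2)) ^ (-1 / p)) * (q / 2 * sinFreq q b ^ 2) * quarterSin q b x ^ (q - 1)| ^ p)
    fun x hx => by
      rw [uIcc_of_le hb.le] at hx
      simp only [h2 x hx], integral_abs_mul_quarterSin_rpow hpq hb, neg_mul, abs_neg,
    mul_right_comm,
    inv_mul_cancel₀ ha.ne', one_mul, abs_of_pos (by positivity), ← Real.rpow_mul hn.le,
    div_mul_cancel₀ _ hpq.ne_zero, Real.rpow_neg_one, inv_mul_cancel₀ hn.ne']

theorem IsNormalizedEigenpair.eq_of_eqOn {p q b lam c : ℝ} [Fact (1 ≤ ENNReal.ofReal p)]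
    [Fact (1 ≤ ENNReal.ofReal q)] {u : ℝ → ℝ} (hpq : p.HolderConjugate q) (hb : 0 < b)
    (h : IsNormalizedEigenpair p q b lam u) (hc : c ≠ 0)
    (hu : ∀ x ∈ Icc 0 b, u x = c * quarterSin q b x) : lam = ‖hilbertianK p q b‖ ^ (-q) := by
  obtain ⟨f, hf1, hr, -, hlam⟩ := h.exists_lp hpq hb
  have := ((isExtremal_iff_reflectedK hpq hb).2
    ⟨c, hc, fun x hx => (hr x hx).trans (hu x hx)⟩).2
  rw [hlam, this, hf1, mul_one]

/-- Each normalised eigenvalue is ‖Kf‖^(-q) for a unit vector f, hence at least ‖K‖^(-q); the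
normalised sine attains this. -/
theorem isFirstEigenvalue {p q b : ℝ} [Fact (1 ≤ ENNReal.ofReal p)]
    [Fact (1 ≤ ENNReal.ofReal q)] (hpq : p.HolderConjugate q) (hb : 0 < b) :
    IsFirstEigenvalue p q b (‖hilbertianK p q b‖ ^ (-q)) := by
  refine ⟨?_, fun m hm => ?_⟩
  · obtain ⟨d, hd, h⟩ := exists_normalized_quarterSin hpq hb
    obtain ⟨lam, h⟩ := h (fun x => d * quarterSin q b x) fun _ _ => rfl
    rw [← h.eq_of_eqOn hpq hb hd fun _ _ => rfl]
    exact ⟨_, h⟩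
  · obtain ⟨v, hv⟩ := hm
    obtain ⟨f, hf1, -, hpos, hlam⟩ := hv.exists_lp hpq hb
    have h := (hilbertianK p q b).le_opNorm f
    rw [hf1, mul_one] at h
    rw [hlam]
    exact Real.rpow_le_rpow_of_nonpos hpos h (by linarith [hpq.symm.pos])

theorem isFirstEigenfunction_iff {p q b : ℝ} [Fact (1 ≤ ENNReal.ofReal p)]
    [Fact (1 ≤ ENNReal.ofReal q)] (hpq : p.HolderConjugate q) (hb : 0 < b) {u : ℝ → ℝ} :
    IsFirstEigenfunction p q b u ↔
      ∃ c : ℝ, c ≠ 0 ∧ ∀ x ∈ Icc 0 b, u x = c * quarterSin q b x := by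
  constructor
  · rintro ⟨c, lam, hc, hlam, h⟩
    obtain ⟨f, hf1, hr, hpos, hl⟩ := h.exists_lp hpq hb
    have hEq := hlam.unique (isFirstEigenvalue hpq hb)
    have hK : ‖hilbertianK p q b f‖ = ‖hilbertianK p q b‖ := by
      rw [hEq, norm_hilbertianK hpq hb] at hl
      rw [norm_hilbertianK hpq hb]
      exact ((Real.rpow_left_inj (sharpConst_pos hpq.symm.lt hb).le hpos.le
        (neg_ne_zero.2 hpq.symm.ne_zero)).1 hl).symm
    obtain ⟨d, hd, hd'⟩ := (isExtremal_iff_reflectedK (q := q) hpq hb (f := f)).1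
      ⟨norm_ne_zero_iff.1 (by rw [hf1]; exact one_ne_zero), by rw [hK, hf1, mul_one]⟩
    refine ⟨d / c, div_ne_zero hd hc, fun x hx => ?_⟩
    rw [div_mul_eq_mul_div, eq_div_iff hc, ← hd' x hx, hr x hx, mul_comm]
  · rintro ⟨c, hc, hu⟩
    obtain ⟨d, hd, h⟩ := exists_normalized_quarterSin hpq hb
    have hdu : ∀ x ∈ Icc 0 b, d / c * u x = d * quarterSin q b x := fun x hx => by
      rw [hu x hx, ← mul_assoc, div_mul_cancel₀ _ hc]
    obtain ⟨lam, h⟩ := h (fun x => d / c * u x) hdu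
    refine ⟨d / c, lam, div_ne_zero hd hc, ?_, h⟩
    rw [h.eq_of_eqOn hpq hb hd hdu]
    exact isFirstEigenvalue hpq hb

/-- Two continuous functions that agree almost everywhere agree everywhere: the integral of their
squared difference is zero. -/
theorem reflectedK_eq_of_ae_eq {p q b : ℝ} [Fact (1 ≤ ENNReal.ofReal p)]
    [Fact (1 ≤ ENNReal.ofReal q)] (hb : 0 < b) {f : LpIoo p b} {u : ℝ → ℝ}
    (hu : ContinuousOn u (Icc 0 b))
    (h : ∀ᵐ x ∂(volIoo b), hilbertianK p q b f x = u (b - x)) {x : ℝ} (hx : x ∈ Icc 0 b) :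
    reflectedK b f x = u x := by
  have h0 : ∫ x in (0 : ℝ)..b, (reflectedK b f x - u x) ^ 2 = 0 := by
    have h1 := intervalIntegral.integral_comp_sub_left (a := 0) (b := b)
      (fun x => (reflectedK b f x - u x) ^ 2) b
    rw [sub_self, sub_zero] at h1
    rw [← h1, integral_congr_volIoo hb.le (g := fun _ => 0), intervalIntegral.integral_zero]
    filter_upwards [h, coeFn_hilbertianK (q := q) f] with x h2 h3
    rw [← h3, h2]; ring
  exact sub_eq_zero.1 (pow_eq_zero_iff two_ne_zero |>.1 (eqOn_zero_of_integral_eq_zero hb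
    (((continuousOn_reflectedK hb f).sub hu).pow 2) (fun x _ => sq_nonneg _) h0 hx))

end

theorem mainTheorem12 (p q b : ℝ) (hpq : p.HolderConjugate q) (hb : 0 < b)
    [Fact (1 ≤ ENNReal.ofReal p)] [Fact (1 ≤ ENNReal.ofReal q)] :
    -- the second factor of `K` is the dual of the first
    (∀ (f : LpIoo p b) (g : LpIoo 2 b),
      ∫ x in (0 : ℝ)..b, hardy p 2 b f x * g x = ∫ x in (0 : ℝ)..b, f x * hardyDual 2 q b g x) ∧
    -- the extremals of `K` correspond to the first eigenfunctions
    (∀ f : LpIoo p b, IsExtremal (hilbertianK p q b) f ↔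
      ∃ u : ℝ → ℝ, IsFirstEigenfunction p q b u ∧
        ∀ᵐ x ∂(volIoo b), hilbertianK p q b f x = u (b - x)) ∧
    (∀ u : ℝ → ℝ, IsFirstEigenfunction p q b u →
      ∃ f : LpIoo p b, IsExtremal (hilbertianK p q b) f ∧
        ∀ᵐ x ∂(volIoo b), hilbertianK p q b f x = u (b - x)) ∧
    -- the extremals of `K` themselves
    (∀ f : LpIoo p b, IsExtremal (hilbertianK p q b) f ↔
      ∃ c : ℝ, c ≠ 0 ∧ ∀ᵐ x ∂(volIoo b),
        f x = c * sinPQ 2 q (piPQ 2 q * (b - x) / (2 * b)) ^ (q - 1)) ∧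
    -- the first eigenfunctions are the nonzero multiples of the generalised sine
    (∀ u : ℝ → ℝ, IsFirstEigenfunction p q b u ↔
      ∃ c : ℝ, c ≠ 0 ∧ ∀ x ∈ Set.Icc 0 b, u x = c * sinPQ 2 q (piPQ 2 q * x / (2 * b))) ∧
    -- the eigenvalue of each of them
    (∀ c : ℝ, c ≠ 0 →
      IsEigenpair p q b (|c| ^ (p - q) * (q / 2 * (piPQ 2 q / (2 * b)) ^ 2) ^ p)
        fun x => c * sinPQ 2 q (piPQ 2 q * x / (2 * b))) ∧
    -- the first eigenvalue, under the normalisation `‖u''‖_p = 1`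
    IsFirstEigenvalue p q b (‖hilbertianK p q b‖ ^ (-q)) ∧
    ‖hilbertianK p q b‖ =
      b ^ (1 + 2 / q) * (q + 2) ^ (1 - 2 / q) * q * 2 ^ (2 / q)
        / (ProbabilityTheory.beta (1 / q) (1 / 2)) ^ 2 := by
  have hq := hpq.symm.lt
  refine ⟨integral_hardy_mul hb.le, fun f => ?_, fun u hu => ?_,
    fun f => isExtremal_iff_ae_eq hpq hb, fun u => isFirstEigenfunction_iff hpq hb,
    fun c hc => (isEigenpair_of_eqOn hpq hb hc fun _ _ => rfl).1, isFirstEigenvalue hpq hb,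
    (norm_hilbertianK hpq hb).trans (sharpConst_eq_beta hq hb)⟩
  · constructor
    · intro hf
      exact ⟨reflectedK b f, (isFirstEigenfunction_iff hpq hb).2
        ((isExtremal_iff_reflectedK hpq hb).1 hf), coeFn_hilbertianK f⟩
    · rintro ⟨u, hu, h⟩
      obtain ⟨c, hc, hu⟩ := (isFirstEigenfunction_iff hpq hb).1 hu
      have huc : ContinuousOn u (Icc 0 b) :=
        (continuousOn_const.mul (continuousOn_quarterSin hq hb)).congr hu
      exact (isExtremal_iff_reflectedK hpq hb).2
        ⟨c, hc, fun x hx => (reflectedK_eq_of_ae_eq hb huc h hx).trans (hu x hx)⟩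
  · obtain ⟨c, hc, hu⟩ := (isFirstEigenfunction_iff hpq hb).1 hu
    have ha := coeff_pos hq hb
    obtain ⟨f, hf⟩ := exists_lp_of_continuousOn (p := p)
      (continuousOn_reflected_quarterSin (c := c * (q / 2 * sinFreq q b ^ 2)) hq hb)
    refine ⟨f, isExtremal_of_ae_eq hpq hb (mul_ne_zero hc ha.ne') hf, ?_⟩
    filter_upwards [coeFn_hilbertianK (q := q) f, ae_restrict_mem measurableSet_Ioo] with x h1 hx
    have hx' := sub_mem_Icc (Ioo_subset_Icc_self hx)
    rw [h1, reflectedK_of_ae_eq hq hb hf hx', hu _ hx', mul_div_cancel_right₀ _ ha.ne']
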